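/- Let $p$ be a prime and let $E$ be a finite extension of $\mathbb{Q}_p$, with the absolute value extending the $p$-adic one. A topological $E$-vector space is *locally convex* if $0$ has a neighbourhood basis of $\mathcal{O}_E$-submodules; Banach spaces over $E$ are complete for an ultrametric norm. All algebras are unital and associative, topological algebras and modules have jointly continuous operations, and modules are left modules unless stated otherwise. **Definitions.** A Hausdorff locally convex space is *hereditarily complete* if all its Hausdorff quotients are complete. A continuous linear map is *BH* if it factors through continuous linear maps into and out of an $E$-Banach space. A *weak Fréchet–Stein structure* on a locally convex topological $E$-algebra $A$ consists of hereditarily complete locally convex topological $E$-algebras $A_n$ ($n\ge 1$), homomorphisms of $E$-algebras $\tau^A_{n+1,n}\colon A_{n+1}\to A_n$ which are BH, and an isomorphism of topological $E$-algebras $A\cong\varprojlim_n A_n$ such that each projection $\mathrm{pr}^A_n\colon A\to A_n$ has dense image. It is a *Fréchet–Stein structure* if moreover each algebra is left Noetherian and each transition map is right flat, i.e. makes its target a flat right module over its source. A locally convex space is of *compact type* if it is the locally convex inductive limit of a sequence of $E$-Banach spaces with injective compact transition maps. An $E$-algebra is of *compact type* if it is a topological $E$-algebra which is the locally convex inductive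 limit of a sequence of left Noetherian $E$-Banach algebras with injective compact algebra homomorphisms as transition maps. The *canonical topology* on a finitely generated module $P$ over an $E$-algebra $C$ of compact type is the compact type topology on $P$ for which $C\times P\to P$ is continuous. For a continuous homomorphism $C\to D$ of locally convex topological $E$-algebras and a locally convex topological $C$-module $P$, the space $D\otimes_C P$ carries the quotient topology of the projective tensor product $D\otimes_{E,\pi}P$, and $D\,\widehat\otimes_C P$ is its Hausdorff completion. A locally convex topological $A$-module $M$ is *coadmissible* with respect to a weak Fréchet–Stein structure $A\cong\varprojlim_n A_n$ if there are finitely generated topological $A_n$-modules $M_n$, isomorphisms of topological $A_n$-modules $A_n\,\widehat\otimes_{A_{n+1}}M_{n+1}\cong M_n$ for all $n\ge1$, and an isomorphism of topological $A$-modules $M\cong\varprojlim_n M_n$, the limit being taken along the maps $M_{n+1}\to A_n\,\widehat\otimes_{A_{n+1}}M_{n+1}\cong M_n$, $x\mapsto 1\otimes x$. Let $\mathrm{pr}^M_n\colon M\to M_n$ be the projections. **Theorem.** Let $A\cong\varprojlim_n A_n$ be a weak Fréchet–Stein algebra such that each $A_n$ is an $E$-algebra of compact type. Let $(B_n,\tau^B_{n+1,n})_{n\ge1}$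 be a projective system of left Noetherian $E$-Banach algebras such that: 1. there are continuous homomorphisms of $E$-algebras $i_n\colon B_n\to A_n$ with $i_n\circ\tau^B_{n+1,n}=\tau^A_{n+1,n}\circ i_{n+1}$ for all $n$; 2. the map $i=\varprojlim_n i_n\colon\varprojlim_n B_n\to\varprojlim_n A_n\cong A$ is an isomorphism of topological $E$-algebras, and via $i^{-1}$ the system $(B_n,\tau^B_{n+1,n})$ is a Fréchet–Stein structure on $A$. Let $M\cong\varprojlim_n M_n$ be a coadmissible $A$-module with respect to the weak Fréchet–Stein structure given by $(A_n)_n$, where each $M_n$ is a finitely generated $A_n$-module equipped with its canonical compact type topology. Then for every $n\ge1$ the canonical map $$\phi_n=\mathrm{id}_{A_n}\otimes\mathrm{pr}^M_n\colon A_n\otimes_A M\longrightarrow M_n,\qquad a\otimes m\longmapsto a\,\mathrm{pr}^M_n(m),$$ from the ordinary (uncompleted) tensor product is a bijection. -/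

import Mathlib

open Topology TensorProduct

namespace FrechetStein

universe u

/-! ### Locally convex spaces over a nonarchimedean field -/

/-- A topological vector space over a nonarchimedean field `E` is locally convex if `0` has a
neighbourhood basis of `𝒪_E`-submodules, where `𝒪_E = {c : ‖c‖ ≤ 1}`. -/
class LocallyConvex (E V : Type*) [NormedField E] [AddCommGroup V] [Module E V]
    [TopologicalSpace V] : Prop where
  exists_lattice : ∀ U ∈ 𝓝 (0 : V), ∃ L : AddSubgroup V,
    (L : Set V) ∈ 𝓝 (0 : V) ∧ (L : Set V) ⊆ U ∧ ∀ c : E, ‖c‖ ≤ 1 → ∀ v ∈ L, c • v ∈ L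

/-- The set of all topologies on the `E`-vector space `V` that make it a locally convex
topological `E`-vector space. -/
def locallyConvexTopologies (E V : Type*) [NormedField E] [AddCommGroup V] [Module E V] :
    Set (TopologicalSpace V) :=
  {t | @IsTopologicalAddGroup V t _ ∧ @ContinuousSMul E V _ _ t ∧ @LocallyConvex E V _ _ _ t}

/-- Every Hausdorff quotient of the Hausdorff topological vector space `V` is complete (the
Hausdorff quotients being those by closed subspaces). -/
def HereditarilyComplete (E V : Type*) [NormedField E] [AddCommGroup V] [Module E V]
    [TopologicalSpace V] [IsTopologicalAddGroup V] : Prop :=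
  T2Space V ∧ ∀ N : Submodule E V, IsClosed (N : Set V) →
    @CompleteSpace (V ⧸ N) (IsTopologicalAddGroup.rightUniformSpace (V ⧸ N))

/-- A linear map is BH if it factors as a composition of continuous linear maps through an
`E`-Banach space. -/
def IsBH {E U : Type*} {V : Type u} [NormedField E] [AddCommGroup U] [Module E U]
    [TopologicalSpace U] [AddCommGroup V] [Module E V] [TopologicalSpace V]
    (f : U →ₗ[E] V) : Prop :=
  ∃ (T : Type u) (_ : NormedAddCommGroup T) (_ : NormedSpace E T) (_ : IsUltrametricDist T)
    (_ : CompleteSpace T) (g : U →L[E] T) (h : T →L[E] V), ∀ u, f u = h (g u)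

/-- `V` is a space of compact type: it is the locally convex inductive limit of a sequence of
`E`-Banach spaces with injective compact transition maps. The injective maps `ι m` identify `V`
with the union of the `X m`, and the topology of `V` is the finest locally convex topology for
which all `ι m` are continuous (in Mathlib's order on topologies, finer means smaller). -/
def IsCompactTypeSpace (E : Type*) (V : Type u) [NormedField E] [AddCommGroup V] [Module E V]
    [tV : TopologicalSpace V] : Prop :=
  ∃ (X : ℕ → Type u) (_ : ∀ m, NormedAddCommGroup (X m)) (_ : ∀ m, NormedSpace E (X m))
    (_ : ∀ m, IsUltrametricDist (X m)) (_ : ∀ m, CompleteSpace (X m))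
    (j : ∀ m, X m →ₗ[E] X (m + 1)) (ι : ∀ m, X m →ₗ[E] V),
    (∀ m, IsCompactOperator (j m)) ∧
    (∀ m x, ι (m + 1) (j m x) = ι m x) ∧
    (∀ m, Function.Injective (ι m)) ∧
    (∀ v, ∃ m, v ∈ Set.range (ι m)) ∧
    tV = sInf {t | t ∈ locallyConvexTopologies E V ∧ ∀ m, Continuous[_, t] (ι m)}

/-- `C` is an algebra of compact type: it is the locally convex inductive limit of a sequence of
left Noetherian `E`-Banach algebras with injective compact algebra homomorphisms as transition
maps. -/
def IsCompactTypeAlgebra (E : Type*) (C : Type u) [NormedField E] [Ring C] [Algebra E C]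
    [tC : TopologicalSpace C] : Prop :=
  ∃ (X : ℕ → Type u) (_ : ∀ m, NormedRing (X m)) (_ : ∀ m, NormedAlgebra E (X m))
    (_ : ∀ m, IsUltrametricDist (X m)) (_ : ∀ m, CompleteSpace (X m))
    (_ : ∀ m, IsNoetherianRing (X m))
    (j : ∀ m, X m →ₐ[E] X (m + 1)) (ι : ∀ m, X m →ₐ[E] C),
    (∀ m, IsCompactOperator (j m)) ∧
    (∀ m x, ι (m + 1) (j m x) = ι m x) ∧
    (∀ m, Function.Injective (ι m)) ∧
    (∀ c, ∃ m, c ∈ Set.range (ι m)) ∧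
    tC = sInf {t | t ∈ locallyConvexTopologies E C ∧ ∀ m, Continuous[_, t] (ι m)}

/-- The maps `π n : Y → X n` identify the topological space `Y` with the projective limit of the
sequence `(X n, τ n)`, i.e. `Y` is mapped homeomorphically onto the space of compatible
sequences, endowed with the subspace topology of the product. -/
def IsProjectiveLimit {X : ℕ → Type*} [∀ n, TopologicalSpace (X n)] (τ : ∀ n, X (n + 1) → X n)
    {Y : Type*} [TopologicalSpace Y] (π : ∀ n, Y → X n) : Prop :=
  IsEmbedding (fun y n => π n y : Y → ∀ n, X n) ∧
    Set.range (fun y n => π n y : Y → ∀ n, X n) = {x | ∀ n, τ n (x (n + 1)) = x n}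

/-! ### Tensor products over noncommutative algebras -/

section BaseChange

variable {E R S : Type*} [NormedField E] [Ring R] [Algebra E R] [Ring S] [Algebra E S]

/-- The `S`-submodule of `S ⊗_E M` spanned by all `s f(r) ⊗ m - s ⊗ r m`. -/
def balancedSubmodule (f : R →ₐ[E] S) (M : Type*) [AddCommGroup M] [Module E M] [Module R M] :
    Submodule S (S ⊗[E] M) :=
  Submodule.span S
    {x | ∃ (s : S) (r : R) (m : M), x = (s * f r) ⊗ₜ[E] m - s ⊗ₜ[E] (r • m)}

/-- The tensor product `S ⊗_R M` of a left `R`-module `M` with `S`, regarded as a right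
`R`-module through the homomorphism of `E`-algebras `f : R → S`, as a quotient of `S ⊗_E M`. -/
def BaseChange (f : R →ₐ[E] S) (M : Type*) [AddCommGroup M] [Module E M] [Module R M] : Type _ :=
  (S ⊗[E] M) ⧸ balancedSubmodule f M

namespace BaseChange

variable (f : R →ₐ[E] S) (M : Type*) [AddCommGroup M] [Module E M] [Module R M]

noncomputable instance : AddCommGroup (BaseChange f M) :=
  inferInstanceAs (AddCommGroup ((S ⊗[E] M) ⧸ balancedSubmodule f M))

noncomputable instance : Module S (BaseChange f M) :=
  inferInstanceAs (Module S ((S ⊗[E] M) ⧸ balancedSubmodule f M))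

/-- The quotient map `S ⊗_E M → S ⊗_R M`. -/
noncomputable def mk : S ⊗[E] M →ₗ[S] BaseChange f M := (balancedSubmodule f M).mkQ

variable {M}

/-- The pure tensor `s ⊗ m` in `S ⊗_R M`. -/
noncomputable def tmul (s : S) (m : M) : BaseChange f M := mk f M (s ⊗ₜ[E] m)

theorem mul_tmul (s : S) (r : R) (m : M) : tmul f (s * f r) m = tmul f s (r • m) := by
  rw [← sub_eq_zero]
  exact (map_sub (mk f M) _ _).symm.trans
    ((Submodule.Quotient.mk_eq_zero _).2 (Submodule.subset_span ⟨s, r, m, rfl⟩))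

/-- A map that is semilinear along an algebra homomorphism is `E`-linear. -/
def restrict [IsScalarTower E R M] {P : Type*} [AddCommGroup P] [Module E P] [Module S P]
    [IsScalarTower E S P] (φ : M →ₛₗ[(f : R →+* S)] P) : M →ₗ[E] P where
  toFun := φ
  map_add' := map_add φ
  map_smul' c m := by
    rw [← algebraMap_smul R c m, map_smulₛₗ]
    simp

/-- The `S`-linear map `S ⊗_R M → P`, `s ⊗ m ↦ s φ(m)`, attached to a map `φ : M → P` from an
`R`-module to an `S`-module that is semilinear along `R → S`. -/
noncomputable def lift [IsScalarTower E R M] {P : Type*} [AddCommGroup P] [Module E P]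
    [Module S P] [IsScalarTower E S P] (φ : M →ₛₗ[(f : R →+* S)] P) :
    BaseChange f M →ₗ[S] P :=
  (balancedSubmodule f M).liftQ
    (TensorProduct.AlgebraTensorModule.lift
      (LinearMap.toSpanSingleton S (M →ₗ[E] P) (restrict f φ)))
    (Submodule.span_le.2 (by
      rintro _ ⟨s, r, m, rfl⟩
      simp [restrict, mul_smul]))

theorem lift_tmul [IsScalarTower E R M] {P : Type*} [AddCommGroup P] [Module E P]
    [Module S P] [IsScalarTower E S P] (φ : M →ₛₗ[(f : R →+* S)] P) (s : S) (m : M) :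
    lift f φ (tmul f s m) = s • φ m := by
  change TensorProduct.AlgebraTensorModule.lift
      (LinearMap.toSpanSingleton S (M →ₗ[E] P) (restrict f φ)) (s ⊗ₜ[E] m) = _
  simp [restrict]

/-- The `S`-linear map `id ⊗ g : S ⊗_R M → S ⊗_R N`. -/
noncomputable def map [IsScalarTower E R M] {N : Type*} [AddCommGroup N] [Module E N]
    [Module R N] [IsScalarTower E R N] (g : M →ₗ[R] N) : BaseChange f M →ₗ[S] BaseChange f N :=
  (balancedSubmodule f M).liftQ
    ((mk f N).comp (TensorProduct.AlgebraTensorModule.map LinearMap.id (g.restrictScalars E)))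
    (Submodule.span_le.2 (by
      rintro _ ⟨s, r, m, rfl⟩
      have := mul_tmul f s r (g m)
      simpa [tmul, sub_eq_zero] using this))

theorem map_tmul [IsScalarTower E R M] {N : Type*} [AddCommGroup N] [Module E N]
    [Module R N] [IsScalarTower E R N] (g : M →ₗ[R] N) (s : S) (m : M) :
    map f g (tmul f s m) = tmul f s (g m) := by
  change mk f N (TensorProduct.AlgebraTensorModule.map LinearMap.id (g.restrictScalars E)
      (s ⊗ₜ[E] m)) = _
  simp [tmul]

end BaseChange

/-- `f : R → S` is right flat, i.e. makes `S` a flat right `R`-module: the functor `S ⊗_R -` on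
left `R`-modules preserves injections. -/
def IsRightFlat {E S : Type*} {R : Type u} [NormedField E] [Ring R] [Algebra E R] [Ring S]
    [Algebra E S] (f : R →ₐ[E] S) : Prop :=
  ∀ (M N : Type u) [AddCommGroup M] [Module E M] [Module R M] [IsScalarTower E R M]
    [AddCommGroup N] [Module E N] [Module R N] [IsScalarTower E R N] (g : M →ₗ[R] N),
    Function.Injective g → Function.Injective (BaseChange.map f g)

/-! ### The topology of `S ⊗_R M` and the completed tensor product -/

/-- The projective tensor product topology on `V ⊗_E W`: the finest locally convex topology for
which `V × W → V ⊗_E W` is jointly continuous. -/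
@[reducible] def projectiveTopology (E V W : Type*) [NormedField E] [AddCommGroup V] [Module E V]
    [TopologicalSpace V] [AddCommGroup W] [Module E W] [TopologicalSpace W] :
    TopologicalSpace (V ⊗[E] W) :=
  sInf {t | t ∈ locallyConvexTopologies E (V ⊗[E] W) ∧
    Continuous[_, t] (fun x : V × W => x.1 ⊗ₜ[E] x.2)}

theorem projectiveTopology_isTopologicalAddGroup (E V W : Type*) [NormedField E] [AddCommGroup V]
    [Module E V] [TopologicalSpace V] [AddCommGroup W] [Module E W] [TopologicalSpace W] :
    @IsTopologicalAddGroup (V ⊗[E] W) (projectiveTopology E V W) _ :=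
  topologicalAddGroup_sInf fun _ ht => ht.1.1

theorem locallyConvexTopologies_induced {E V W : Type*} [NormedField E] [AddCommGroup V]
    [Module E V] [AddCommGroup W] [Module E W] (g : V →ₗ[E] W) {t : TopologicalSpace W}
    (ht : t ∈ locallyConvexTopologies E W) :
    t.induced g ∈ locallyConvexTopologies E V := by
  obtain ⟨h1, h2, h3⟩ := ht
  refine ⟨topologicalAddGroup_induced g, continuousSMul_induced g, ?_⟩
  refine @LocallyConvex.mk _ _ _ _ _ (t.induced g) fun U hU => ?_
  rw [nhds_induced, map_zero] at hU
  obtain ⟨U', hU', hU⟩ := hU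
  obtain ⟨L, hL, hLU, hs⟩ := h3.exists_lattice U' hU'
  refine ⟨L.comap (g : V →+ W), ?_, fun v hv => hU (hLU hv), fun c hc v hv => ?_⟩
  · rw [nhds_induced, map_zero]
    exact ⟨L, hL, fun v hv => hv⟩
  · have : g (c • v) ∈ L := by
      rw [map_smul]
      exact hs c hc _ hv
    exact this

theorem projectiveTopology_continuous_smul (E V W : Type*) [NormedField E] [Ring V]
    [Algebra E V] [TopologicalSpace V] [IsTopologicalRing V] [AddCommGroup W] [Module E W]
    [TopologicalSpace W] (s : V) :
    Continuous[projectiveTopology E V W, projectiveTopology E V W]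
      (fun x : V ⊗[E] W => s • x) := by
  refine continuous_sInf_rng.2 fun t ht => ?_
  refine continuous_iff_le_induced.2 (sInf_le ⟨?_, ?_⟩)
  · exact locallyConvexTopologies_induced
      (Algebra.lsmul E E (V ⊗[E] W) s) ht.1
  · refine continuous_induced_rng.2 ?_
    exact ht.2.comp ((continuous_const.mul continuous_fst).prodMk continuous_snd)

namespace BaseChange

variable [TopologicalSpace S] (f : R →ₐ[E] S) (M : Type*) [AddCommGroup M] [Module E M]
  [Module R M] [TopologicalSpace M]

/-- `S ⊗_R M` carries the quotient topology of the projective tensor product `S ⊗_{E,π} M`. -/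
noncomputable instance : TopologicalSpace (BaseChange f M) :=
  (projectiveTopology E S M).coinduced (mk f M)

instance : IsTopologicalAddGroup (BaseChange f M) := by
  let := projectiveTopology E S M
  have := projectiveTopology_isTopologicalAddGroup E S M
  exact inferInstanceAs (IsTopologicalAddGroup ((S ⊗[E] M) ⧸ balancedSubmodule f M))

noncomputable instance : UniformSpace (BaseChange f M) :=
  IsTopologicalAddGroup.rightUniformSpace (BaseChange f M)

instance : IsUniformAddGroup (BaseChange f M) :=
  isUniformAddGroup_of_addCommGroup

instance [IsTopologicalRing S] : UniformContinuousConstSMul S (BaseChange f M) := by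
  refine ⟨fun s => ?_⟩
  refine uniformContinuous_of_continuousAt_zero
    (DistribSMul.toAddMonoidHom (BaseChange f M) s) (Continuous.continuousAt ?_)
  refine continuous_coinduced_dom.2 ?_
  let := projectiveTopology E S M
  have h : Continuous (mk f M) := continuous_coinduced_rng
  exact h.comp (projectiveTopology_continuous_smul E S M s)

end BaseChange

/-- The completed tensor product `S ⊗̂_R M`: the (Hausdorff) completion of `S ⊗_R M`. It is an
`S`-module by continuous extension of the action on `S ⊗_R M`. -/
abbrev CompletedBaseChange [TopologicalSpace S] (f : R →ₐ[E] S) (M : Type*) [AddCommGroup M]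
    [Module E M] [Module R M] [TopologicalSpace M] : Type _ :=
  UniformSpace.Completion (BaseChange f M)

end BaseChange

/-! ### (Weak) Fréchet–Stein structures and coadmissible modules -/

/-- A weak Fréchet–Stein structure on the topological `E`-algebra `A`, given by topological
`E`-algebras `X n`, transition maps `τ n` and projections `pr n`. -/
structure IsWeakFrechetStein {E A : Type*} {X : ℕ → Type*} [NormedField E] [Ring A] [Algebra E A]
    [TopologicalSpace A] [∀ n, Ring (X n)] [∀ n, Algebra E (X n)] [∀ n, TopologicalSpace (X n)]
    [∀ n, IsTopologicalRing (X n)] (τ : ∀ n, X (n + 1) →ₐ[E] X n) (pr : ∀ n, A →ₐ[E] X n) :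
    Prop where
  continuousSMul : ∀ n, ContinuousSMul E (X n)
  locallyConvex : ∀ n, LocallyConvex E (X n)
  hereditarilyComplete : ∀ n, HereditarilyComplete E (X n)
  isBH : ∀ n, IsBH (τ n).toLinearMap
  isProjectiveLimit : IsProjectiveLimit (fun n => τ n) (fun n => pr n)
  denseRange : ∀ n, DenseRange (pr n)

/-- A Fréchet–Stein structure: a weak Fréchet–Stein structure with left Noetherian algebras
and right flat transition maps. -/
structure IsFrechetStein {E A : Type*} {X : ℕ → Type*} [NormedField E] [Ring A] [Algebra E A]
    [TopologicalSpace A] [∀ n, Ring (X n)] [∀ n, Algebra E (X n)] [∀ n, TopologicalSpace (X n)]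
    [∀ n, IsTopologicalRing (X n)] (τ : ∀ n, X (n + 1) →ₐ[E] X n) (pr : ∀ n, A →ₐ[E] X n) : Prop
    extends IsWeakFrechetStein τ pr where
  isNoetherianRing : ∀ n, IsNoetherianRing (X n)
  isRightFlat : ∀ n, IsRightFlat (τ n)

/-- The topological modules `N n` over the `X n` form an `{X n}`-sequence for the topological
`A`-module `M`, with projections `prM n : M → N n`: each `N n` is finitely generated, and there
are isomorphisms of topological modules `X n ⊗̂_{X (n+1)} N (n+1) ≅ N n` such that the `prM n`
identify `M` with the projective limit of the `N n` along the transition maps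
`N (n+1) → X n ⊗̂_{X (n+1)} N (n+1) ≅ N n`, `x ↦ 1 ⊗ x`. So `M` is coadmissible if such a
sequence exists. -/
structure IsCoadmissibleSequence {E A : Type*} {X : ℕ → Type*} [NormedField E] [Ring A]
    [Algebra E A] [∀ n, Ring (X n)] [∀ n, Algebra E (X n)] [∀ n, TopologicalSpace (X n)]
    [∀ n, IsTopologicalRing (X n)] (τ : ∀ n, X (n + 1) →ₐ[E] X n) (pr : ∀ n, A →ₐ[E] X n)
    {M : Type*} {N : ℕ → Type*} [AddCommGroup M] [Module A M] [TopologicalSpace M]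
    [∀ n, AddCommGroup (N n)] [∀ n, Module E (N n)] [∀ n, Module (X n) (N n)]
    [∀ n, TopologicalSpace (N n)] (prM : ∀ n, M →ₛₗ[(pr n : A →+* X n)] N n) : Prop where
  finite : ∀ n, Module.Finite (X n) (N n)
  exists_iso : ∃ e : ∀ n, CompletedBaseChange (τ n) (N (n + 1)) ≃L[X n] N n,
    IsProjectiveLimit
      (fun n x => e n ((BaseChange.tmul (τ n) 1 x : BaseChange (τ n) (N (n + 1))) :
        CompletedBaseChange (τ n) (N (n + 1))))
      (fun n => prM n)

end FrechetStein

open FrechetStein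

namespace FrechetStein

/-! ### Semilinear maps that exhibit their target as a base change -/

section Algebraic

variable {E : Type*} [NormedField E]
variable {R : Type*} [Ring R] [Algebra E R] {S : Type*} [Ring S] [Algebra E S]
variable {T : Type*} [Ring T] [Algebra E T]
variable {M : Type*} [AddCommGroup M] [Module E M] [Module R M]
variable {N : Type*} [AddCommGroup N] [Module E N] [Module S N] [IsScalarTower E S N]
variable {P : Type*} [AddCommGroup P]

/-! The theorem is first reduced to ordinary tensor products, then transported to the Fréchet–Stein
structure `B`, where Noetherianity and flatness are available.

Over an algebra of compact type, every submodule of a finitely generated module with its canonical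
topology is closed (`IsCompactTypeAlgebra.isClosed_submodule`). This holds because closedness in an
inductive limit along compact maps can be tested on the Banach steps, and submodules of finite free
modules over a Noetherian Banach algebra are closed. Hence `A_n ⊗ M_{n+1}` is Hausdorff and embeds
in its completion `M_n`; its image is a dense submodule, so it is everything. The completion is
therefore superfluous (`isBaseChangeMap_of_completed`).

The continuous map `A → B_k` is bounded on the preimage of a neighbourhood of zero in some `A_m`, so
it extends by density to `s_k : A_{m_k} → B_k`. The two systems interleave. Put `L_k = B_k ⊗
M_{m_k}`, the tensor product being over `A_{m_k}`. The `L_k` form a coherent sequence over the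
Fréchet–Stein structure, again with limit `M`.

For such a sequence `B_k ⊗_A M → L_k` is bijective (`isBaseChangeMap_of_coherent`). Mittag-Leffler
and closedness of submodules show that compatible families generate each term. Applied to the `L_k`
this gives surjectivity; applied to modules of relations, which are coherent enough by flatness, it
gives injectivity.

Finally `A_n ⊗_{B_n} L_n = M_n`, because `A_{m_n} → B_n → A_n` is the transition map, and
transitivity of base change along `A → B_n → A_n` concludes (`isBaseChangeMap_of_ladder`). -/

instance BaseChange.instModuleBase (f : R →ₐ[E] S) (M : Type*) [AddCommGroup M] [Module E M]
    [Module R M] : Module E (BaseChange f M) :=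
  inferInstanceAs (Module E ((S ⊗[E] M) ⧸ balancedSubmodule f M))

instance BaseChange.instIsScalarTower (f : R →ₐ[E] S) (M : Type*) [AddCommGroup M] [Module E M]
    [Module R M] : IsScalarTower E S (BaseChange f M) :=
  inferInstanceAs (IsScalarTower E S ((S ⊗[E] M) ⧸ balancedSubmodule f M))

theorem BaseChange.tmul_add (f : R →ₐ[E] S) (s : S) (m m' : M) :
    tmul f s (m + m') = tmul f s m + tmul f s m' := by
  simp [tmul, TensorProduct.tmul_add]

theorem BaseChange.smul_tmul' (f : R →ₐ[E] S) (s s' : S) (m : M) :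
    s • tmul f s' m = tmul f (s * s') m := by
  rw [tmul, ← map_smul, TensorProduct.smul_tmul', smul_eq_mul]
  rfl

theorem BaseChange.smul_one_tmul (f : R →ₐ[E] S) (s : S) (m : M) :
    s • tmul f 1 m = tmul f s m := by
  rw [smul_tmul', mul_one]

theorem BaseChange.induction_on (f : R →ₐ[E] S) {motive : BaseChange f M → Prop}
    (x : BaseChange f M) (zero : motive 0) (tmul : ∀ s m, motive (tmul f s m))
    (add : ∀ x y, motive x → motive y → motive (x + y)) : motive x := by
  obtain ⟨x, rfl⟩ := Submodule.Quotient.mk_surjective _ x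
  induction x with
  | zero => exact zero
  | tmul s m => exact tmul s m
  | add x y hx hy => exact add _ _ hx hy

/-- Every element of `S ⊗_R M` is a finite sum of pure tensors. -/
theorem BaseChange.exists_sum (f : R →ₐ[E] S) (x : BaseChange f M) :
    ∃ (r : ℕ) (s : Fin r → S) (m : Fin r → M), x = ∑ i, tmul f (s i) (m i) := by
  induction x using BaseChange.induction_on with
  | zero => exact ⟨0, 0, 0, by simp⟩
  | tmul s m => exact ⟨1, fun _ => s, fun _ => m, by simp⟩
  | add x y hx hy =>
    obtain ⟨r, s, m, rfl⟩ := hx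
    obtain ⟨r', s', m', rfl⟩ := hy
    exact ⟨r + r', Fin.append s s', Fin.append m m', by simp [Fin.sum_univ_add]⟩

/-- The canonical map `M → S ⊗_R M`. -/
noncomputable def BaseChange.unit (f : R →ₐ[E] S) (M : Type*) [AddCommGroup M] [Module E M]
    [Module R M] : M →ₛₗ[(f : R →+* S)] BaseChange f M where
  toFun m := tmul f 1 m
  map_add' := tmul_add f 1
  map_smul' r m := by
    rw [← mul_tmul, one_mul, RingHom.coe_coe, smul_one_tmul]

theorem BaseChange.map_eq_of_apply {f : R →ₐ[E] S} {A B : Type*} [AddCommGroup B]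
    [FunLike A (BaseChange f M) B] [AddMonoidHomClass A (BaseChange f M) B] {u v : A}
    (h : ∀ s m, u (tmul f s m) = v (tmul f s m)) : u = v := by
  refine DFunLike.ext _ _ fun x => ?_
  induction x using BaseChange.induction_on with
  | zero => simp
  | tmul s m => exact h s m
  | add x y hx hy => rw [map_add, map_add, hx, hy]

variable [IsScalarTower E R M]

/-- `φ : M → N` exhibits `N` as the base change `S ⊗_R M`. -/
def IsBaseChangeMap (f : R →ₐ[E] S) (φ : M →ₛₗ[(f : R →+* S)] N) : Prop :=
  Function.Bijective (BaseChange.lift f φ)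

theorem BaseChange.lift_unit (f : R →ₐ[E] S) :
    lift f (unit f M) = LinearMap.id := by
  ext x
  induction x using BaseChange.induction_on with
  | zero => simp
  | tmul s m => rw [lift_tmul]; exact smul_one_tmul f s m
  | add x y hx hy => rw [map_add, hx, hy]; rfl

theorem isBaseChangeMap_unit (f : R →ₐ[E] S) : IsBaseChangeMap f (BaseChange.unit f M) := by
  rw [IsBaseChangeMap, BaseChange.lift_unit]
  exact Function.bijective_id

/-- Pointwise hypotheses, because `algTransition` from a term to itself is only known to agree with
the identity pointwise. -/
theorem isBaseChangeMap_of_eq_self {f : R →ₐ[E] R} {φ : M →ₛₗ[(f : R →+* R)] M}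
    (hf : ∀ r, f r = r) (hφ : ∀ m, φ m = m) : IsBaseChangeMap f φ := by
  refine ⟨fun x y h => ?_, fun m => ⟨BaseChange.tmul _ 1 m, by simp [BaseChange.lift_tmul, hφ]⟩⟩
  have key : ∀ x : BaseChange f M, x = BaseChange.tmul _ 1 (BaseChange.lift f φ x) := by
    intro x
    induction x using BaseChange.induction_on with
    | zero => rw [map_zero]; exact ((BaseChange.unit f M).map_zero).symm
    | tmul s m => rw [BaseChange.lift_tmul, ← BaseChange.mul_tmul, hφ, one_mul, hf]
    | add x y hx hy => rw [map_add, BaseChange.tmul_add, ← hx, ← hy]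
  rw [key x, key y, h]

theorem IsBaseChangeMap.span_range {f : R →ₐ[E] S} {φ : M →ₛₗ[(f : R →+* S)] N}
    (hφ : IsBaseChangeMap f φ) : Submodule.span S (Set.range φ) = ⊤ := by
  refine eq_top_iff.2 fun y _ => ?_
  obtain ⟨x, rfl⟩ := hφ.2 y
  induction x using BaseChange.induction_on with
  | zero => simp
  | tmul s m =>
    rw [BaseChange.lift_tmul]
    exact Submodule.smul_mem _ _ (Submodule.subset_span ⟨m, rfl⟩)
  | add x y hx hy => rw [map_add]; exact add_mem (hx trivial) (hy trivial)

/-- Semilinear maps out of a base change agree if they agree on the image of `M`. -/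
theorem IsBaseChangeMap.ext {f : R →ₐ[E] S} {φ : M →ₛₗ[(f : R →+* S)] N}
    (hφ : IsBaseChangeMap f φ) {T : Type*} [Ring T] {g : S →+* T} [Module T P] {ψ ψ' : N → P} (h0 : ∀ x y, ψ (x + y) = ψ x + ψ y)
    (h1 : ∀ x y, ψ' (x + y) = ψ' x + ψ' y) (h2 : ∀ s x, ψ (s • x) = g s • ψ x)
    (h3 : ∀ s x, ψ' (s • x) = g s • ψ' x) (h : ∀ m, ψ (φ m) = ψ' (φ m)) (y : N) : ψ y = ψ' y := by
  have hy : y ∈ Submodule.span S (Set.range φ) := hφ.span_range ▸ trivial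
  induction hy using Submodule.span_induction with
  | mem x hx => obtain ⟨m, rfl⟩ := hx; exact h m
  | zero => rw [← zero_smul S (0 : N), h2, h3, map_zero, zero_smul, zero_smul]
  | add x y _ _ hx hy => rw [h0, h1, hx, hy]
  | smul s x _ hx => rw [h2, h3, hx]

variable [Module E P] [Module T P] [IsScalarTower E T P]

/-- The semilinear map `S ⊗_R M → P` over `S → T` attached to a semilinear map `M → P` over the
composition `R → S → T`. -/
theorem BaseChange.exists_semilinear (f : R →ₐ[E] S) (g : S →ₐ[E] T) (h : R →ₐ[E] T)
    (hgf : ∀ r, h r = g (f r)) (χ : M →ₛₗ[(h : R →+* T)] P) :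
    ∃ ψ : BaseChange f M →ₛₗ[(g : S →+* T)] P, ∀ s m, ψ (tmul f s m) = g s • χ m := by
  -- With `P` viewed as an `S`-module through `g`, this is the universal property along `R → S`.
  let : Module S P := Module.compHom P (g : S →+* T)
  have : IsScalarTower E S P := ⟨fun c s x => by
    change g (c • s) • x = c • (g s • x)
    rw [map_smul, smul_assoc]⟩
  let χ' : M →ₛₗ[(f : R →+* S)] P :=
    { toFun := χ
      map_add' := map_add χ
      map_smul' := fun r m => by
        rw [map_smulₛₗ]
        change h r • χ m = g (f r) • χ m
        rw [hgf] }
  refine ⟨{ toFun := lift f χ', map_add' := map_add _, map_smul' := fun s x => ?_ },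
    fun s m => lift_tmul f χ' s m⟩
  exact map_smul (lift f χ') s x

/-- A semilinear map on `M` extends to a base change of `M`. -/
theorem IsBaseChangeMap.exists_extension {f : R →ₐ[E] S} {φ : M →ₛₗ[(f : R →+* S)] N}
    (hφ : IsBaseChangeMap f φ) (g : S →ₐ[E] T) (h : R →ₐ[E] T)
    (hgf : ∀ r, h r = g (f r)) (χ : M →ₛₗ[(h : R →+* T)] P) :
    ∃ ψ : N →ₛₗ[(g : S →+* T)] P, ∀ m, ψ (φ m) = χ m := by
  obtain ⟨ψ, hψ⟩ := BaseChange.exists_semilinear f g h hgf χ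
  let e := LinearEquiv.ofBijective _ hφ
  refine ⟨ψ.comp (e.symm : N →ₗ[S] BaseChange f M), fun m => ?_⟩
  have : φ m = e (BaseChange.tmul f 1 m) := by
    change φ m = BaseChange.lift f φ (BaseChange.tmul f 1 m)
    rw [BaseChange.lift_tmul, one_smul]
  simp [this, hψ]

theorem IsBaseChangeMap.of_equiv {f : R →ₐ[E] S} {φ : M →ₛₗ[(f : R →+* S)] N}
    (hφ : IsBaseChangeMap f φ) {N' : Type*} [AddCommGroup N'] [Module E N'] [Module S N']
    [IsScalarTower E S N'] (e : N ≃ₗ[S] N') {φ' : M →ₛₗ[(f : R →+* S)] N'}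
    (h : ∀ m, φ' m = e (φ m)) : IsBaseChangeMap f φ' := by
  have : BaseChange.lift f φ' = e.toLinearMap.comp (BaseChange.lift f φ) := by
    refine BaseChange.map_eq_of_apply fun s m => ?_
    simp [BaseChange.lift_tmul, h]
  rw [IsBaseChangeMap, this]
  exact e.bijective.comp hφ

/-- For a base change `M → N` along `R → S`, the map `T ⊗_R M → T ⊗_S N` is bijective; so a
semilinear map `N → P` is a base change if and only if `M → N → P` is. -/
theorem IsBaseChangeMap.comp_iff {f : R →ₐ[E] S} {φ : M →ₛₗ[(f : R →+* S)] N}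
    (hφ : IsBaseChangeMap f φ) {g : S →ₐ[E] T} {h : R →ₐ[E] T}
    (hgf : ∀ r, h r = g (f r)) {ψ : N →ₛₗ[(g : S →+* T)] P} {χ : M →ₛₗ[(h : R →+* T)] P}
    (hχ : ∀ m, χ m = ψ (φ m)) : IsBaseChangeMap h χ ↔ IsBaseChangeMap g ψ := by
  let φ' : M →ₛₗ[(h : R →+* T)] BaseChange g N :=
    { toFun := fun m => BaseChange.unit g N (φ m)
      map_add' := by simp
      map_smul' := fun r m => by
        rw [map_smulₛₗ, map_smulₛₗ]
        simp [hgf] }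
  let γ : BaseChange h M →ₗ[T] BaseChange g N := BaseChange.lift h φ'
  -- The inverse of `γ` comes from extending `m ↦ 1 ⊗ m` along `φ` to all of `N`.
  obtain ⟨δ₀, hδ₀⟩ := hφ.exists_extension g h hgf (BaseChange.unit h M)
  let δ : BaseChange g N →ₗ[T] BaseChange h M := BaseChange.lift g δ₀
  have hδγ : δ.comp γ = LinearMap.id := by
    refine BaseChange.map_eq_of_apply fun t m => ?_
    rw [LinearMap.comp_apply, BaseChange.lift_tmul, map_smul]
    change t • δ (BaseChange.tmul g 1 (φ m)) = _
    rw [BaseChange.lift_tmul, hδ₀, one_smul]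
    exact BaseChange.smul_one_tmul h t m
  have hγδ : γ.comp δ = LinearMap.id := by
    have key : ∀ y, γ (δ₀ y) = BaseChange.unit g N y := by
      refine hφ.ext (g := (g : S →+* T)) (fun x y => by simp) (fun x y => by simp)
        (fun s x => ?_) (fun s x => by rw [map_smulₛₗ]) fun m => ?_
      · rw [map_smulₛₗ, map_smul]
      · rw [hδ₀]
        change γ (BaseChange.tmul h 1 m) = _
        rw [BaseChange.lift_tmul, one_smul]
        rfl
    refine BaseChange.map_eq_of_apply fun t y => ?_
    rw [LinearMap.comp_apply, BaseChange.lift_tmul, map_smul, key]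
    exact BaseChange.smul_one_tmul g t y
  have hγ : Function.Bijective γ := Function.bijective_iff_has_inverse.2
    ⟨δ, fun x => DFunLike.congr_fun hδγ x, fun x => DFunLike.congr_fun hγδ x⟩
  have hcomp : BaseChange.lift h χ = (BaseChange.lift g ψ).comp γ := by
    refine BaseChange.map_eq_of_apply fun t m => ?_
    rw [LinearMap.comp_apply, BaseChange.lift_tmul, BaseChange.lift_tmul, map_smul]
    change _ = t • BaseChange.lift g ψ (BaseChange.tmul g 1 (φ m))
    rw [BaseChange.lift_tmul, one_smul, hχ]
  rw [IsBaseChangeMap, IsBaseChangeMap, hcomp, LinearMap.coe_comp]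
  exact ⟨fun H => (Function.Bijective.of_comp_iff _ hγ).1 H, fun H => H.comp hγ⟩

end Algebraic

/-! ### Iterated transition maps -/

section Transition

variable {X : ℕ → Type*}

/-- The composition `X m → X n` of the transition maps of a projective sequence. -/
def transition (t : ∀ n, X (n + 1) → X n) {n m : ℕ} (h : n ≤ m) : X m → X n :=
  Nat.leRecOn (C := fun k => X k → X n) h (fun {k} g x => g (t k x)) id

variable (t : ∀ n, X (n + 1) → X n)

theorem transition_refl {n : ℕ} (h : n ≤ n) (x : X n) : transition t h x = x := by
  rw [transition, Nat.leRecOn_self]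
  rfl

theorem transition_succ {n m : ℕ} (h : n ≤ m) (h' : n ≤ m + 1) (x : X (m + 1)) :
    transition t h' x = transition t h (t m x) := by
  rw [transition, Nat.leRecOn_succ h]
  rfl

theorem transition_transition {n m l : ℕ} (h : n ≤ m) (h' : m ≤ l) (x : X l) :
    transition t h (transition t h' x) = transition t (h.trans h') x := by
  induction l, h' using Nat.le_induction with
  | base => rw [transition_refl]
  | succ l hl ih => rw [transition_succ t hl, ih, transition_succ t (h.trans hl)]

theorem transition_one {n : ℕ} (h : n ≤ n + 1) (x : X (n + 1)) : transition t h x = t n x := by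
  rw [transition_succ t le_rfl, transition_refl]

theorem transition_apply_of_compatible {n m : ℕ} (h : n ≤ m) {x : ∀ n, X n}
    (hx : ∀ n, t n (x (n + 1)) = x n) : transition t h (x m) = x n := by
  induction m, h using Nat.le_induction with
  | base => rw [transition_refl]
  | succ m hm ih => rw [transition_succ t hm, hx, ih]

theorem continuous_transition [∀ n, TopologicalSpace (X n)] (ht : ∀ n, Continuous (t n))
    {n m : ℕ} (h : n ≤ m) : Continuous (transition t h) := by
  induction m, h using Nat.le_induction with
  | base => exact continuous_id.congr fun x => (transition_refl t le_rfl x).symm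
  | succ m hm ih => exact (ih.comp (ht m)).congr fun x => (transition_succ t hm _ x).symm

variable {E : Type*} [NormedField E] [∀ n, Ring (X n)] [∀ n, Algebra E (X n)]

/-- `transition` composes bare functions, so that it serves algebras and modules alike, the maps
between the latter being semilinear over varying homomorphisms. The algebra structure is recovered
afterwards. -/
theorem exists_algHom_transition (τ : ∀ n, X (n + 1) →ₐ[E] X n) {n m : ℕ} (h : n ≤ m) :
    ∃ f : X m →ₐ[E] X n, ∀ x, f x = transition (fun n => τ n) h x := by
  induction m, h using Nat.le_induction with
  | base => exact ⟨AlgHom.id E _, fun x => (transition_refl _ le_rfl x).symm⟩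
  | succ m hm ih =>
    obtain ⟨f, hf⟩ := ih
    exact ⟨f.comp (τ m), fun x => by rw [transition_succ _ hm, ← hf]; rfl⟩

/-- The composition `X m → X n` of the transition maps of a projective sequence of algebras. -/
noncomputable def algTransition (τ : ∀ n, X (n + 1) →ₐ[E] X n) {n m : ℕ} (h : n ≤ m) :
    X m →ₐ[E] X n :=
  (exists_algHom_transition τ h).choose

theorem algTransition_apply (τ : ∀ n, X (n + 1) →ₐ[E] X n) {n m : ℕ} (h : n ≤ m) (x : X m) :
    algTransition τ h x = transition (fun n => τ n) h x :=
  (exists_algHom_transition τ h).choose_spec x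

/-- Transitivity of base change, in the form `comp_iff`, adds one step of the tower at a time. -/
theorem exists_isBaseChangeMap_transition (τ : ∀ n, X (n + 1) →ₐ[E] X n) {N : ℕ → Type*}
    [∀ n, AddCommGroup (N n)] [∀ n, Module E (N n)] [∀ n, Module (X n) (N n)]
    [∀ n, IsScalarTower E (X n) (N n)]
    (t : ∀ n, N (n + 1) →ₛₗ[(τ n : X (n + 1) →+* X n)] N n)
    (ht : ∀ n, IsBaseChangeMap (τ n) (t n)) {n m : ℕ} (h : n ≤ m) :
    ∃ φ : N m →ₛₗ[(algTransition τ h : X m →+* X n)] N n,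
      (∀ x, φ x = transition (fun n => t n) h x) ∧ IsBaseChangeMap (algTransition τ h) φ := by
  induction m, h using Nat.le_induction with
  | base =>
    have h1 : ∀ x, algTransition τ (le_refl n) x = x := fun x => by
      rw [algTransition_apply, transition_refl]
    exact ⟨{ toFun := id, map_add' := fun _ _ => rfl, map_smul' := fun r x => by simp [h1] },
      fun x => (transition_refl _ le_rfl x).symm, isBaseChangeMap_of_eq_self h1 fun _ => rfl⟩
  | succ m hm ih =>
    obtain ⟨φ, hφ, hb⟩ := ih
    have h1 : ∀ x, algTransition τ (hm.trans m.le_succ) x = algTransition τ hm (τ m x) := by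
      intro x
      rw [algTransition_apply, algTransition_apply, transition_succ _ hm]
    refine ⟨{ toFun := fun x => φ (t m x), map_add' := by simp, map_smul' := fun r x => ?_ },
      fun x => ?_, ?_⟩
    · rw [map_smulₛₗ, map_smulₛₗ]
      congr 1
      exact (h1 r).symm
    · rw [transition_succ _ hm, ← hφ]
      rfl
    · exact ((ht m).comp_iff h1 fun x => rfl).2 hb

end Transition

/-! ### Locally convex inductive limits of sequences of Banach spaces -/

section Lattice

variable {E : Type*} [NontriviallyNormedField E] {V : Type*} [AddCommGroup V] [Module E V]

/-- The vector space topology for which the nonzero multiples of an absorbing lattice form a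
basis of neighbourhoods of zero. -/
def latticeFilterBasis (L : AddSubgroup V) (hL : ∀ c : E, ‖c‖ ≤ 1 → ∀ v ∈ L, c • v ∈ L)
    (habs : ∀ v : V, ∃ c : E, c ≠ 0 ∧ c • v ∈ L) : ModuleFilterBasis E V where
  sets := Set.range fun c : Eˣ => {v : V | (c : E) • v ∈ L}
  nonempty := ⟨_, 1, rfl⟩
  inter_sets := by
    rintro _ _ ⟨c, rfl⟩ ⟨d, rfl⟩
    rcases le_total ‖(c : E)‖ ‖(d : E)‖ with h | h
    · refine ⟨_, ⟨d, rfl⟩, fun v hv => ⟨?_, hv⟩⟩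
      have := hL ((c : E) * (d : E)⁻¹) (by
        rw [norm_mul, norm_inv]; exact div_le_one_of_le₀ h (norm_nonneg _)) _ hv
      rwa [smul_smul, inv_mul_cancel_right₀ d.ne_zero] at this
    · refine ⟨_, ⟨c, rfl⟩, fun v hv => ⟨hv, ?_⟩⟩
      have := hL ((d : E) * (c : E)⁻¹) (by
        rw [norm_mul, norm_inv]; exact div_le_one_of_le₀ h (norm_nonneg _)) _ hv
      rwa [smul_smul, inv_mul_cancel_right₀ c.ne_zero] at this
  zero' := by
    rintro _ ⟨c, rfl⟩
    simp [zero_mem]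
  add' := by
    rintro _ ⟨c, rfl⟩
    refine ⟨_, ⟨c, rfl⟩, ?_⟩
    rintro _ ⟨v, hv, w, hw, rfl⟩
    simpa [smul_add] using add_mem hv hw
  neg' := by
    rintro _ ⟨c, rfl⟩
    refine ⟨_, ⟨c, rfl⟩, fun v hv => ?_⟩
    simpa using hv
  conj' := by
    rintro v _ ⟨c, rfl⟩
    refine ⟨_, ⟨c, rfl⟩, fun w hw => ?_⟩
    simpa using hw
  smul' := by
    rintro _ ⟨c, rfl⟩
    refine ⟨Metric.closedBall 0 1, Metric.closedBall_mem_nhds _ one_pos, _, ⟨c, rfl⟩, ?_⟩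
    rintro _ ⟨d, hd, v, hv, rfl⟩
    have := hL d (by simpa using hd) _ hv
    rwa [smul_comm] at this
  smul_left' := by
    rintro d _ ⟨c, rfl⟩
    by_cases hd : d = 0
    · exact ⟨_, ⟨1, rfl⟩, fun v _ => by simp [hd, zero_mem]⟩
    · exact ⟨_, ⟨c * Units.mk0 d hd, rfl⟩, fun v hv => by simpa [mul_smul] using hv⟩
  smul_right' := by
    rintro v _ ⟨c, rfl⟩
    obtain ⟨d, hd, hdv⟩ := habs v
    -- For `‖x‖ ≤ ‖d‖ / ‖c‖` the scalar `c * x * d⁻¹` has norm at most one and carries `d • v ∈ L`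
    -- to `c • x • v`.
    have hpos : 0 < ‖d‖ / ‖(c : E)‖ := div_pos (norm_pos_iff.2 hd) (norm_pos_iff.2 c.ne_zero)
    filter_upwards [Metric.closedBall_mem_nhds (0 : E) hpos] with x hx
    have hx' : ‖x‖ ≤ ‖d‖ / ‖(c : E)‖ := by simpa using hx
    have := hL ((c : E) * x * d⁻¹) (by
      rw [norm_mul, norm_mul, norm_inv]
      refine div_le_one_of_le₀ ?_ (norm_nonneg _)
      rwa [mul_comm, ← le_div_iff₀ (norm_pos_iff.2 c.ne_zero)]) _ hdv
    rw [smul_smul, inv_mul_cancel_right₀ hd, mul_smul] at this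
    exact this

theorem latticeFilterBasis_mem (L : AddSubgroup V)
    (hL : ∀ c : E, ‖c‖ ≤ 1 → ∀ v ∈ L, c • v ∈ L)
    (habs : ∀ v : V, ∃ c : E, c ≠ 0 ∧ c • v ∈ L) :
    (latticeFilterBasis L hL habs).topology ∈ locallyConvexTopologies E V := by
  let B := latticeFilterBasis L hL habs
  refine ⟨B.isTopologicalAddGroup, B.continuousSMul, ?_⟩
  refine @LocallyConvex.mk _ _ _ _ _ B.topology fun U hU => ?_
  obtain ⟨_, ⟨c, rfl⟩, hcU⟩ := B.toAddGroupFilterBasis.nhds_zero_hasBasis.mem_iff.1 hU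
  refine ⟨{ carrier := {v | (c : E) • v ∈ L}
            add_mem' := fun {a b} ha hb => ?_
            zero_mem' := ?_
            neg_mem' := fun {a} ha => ?_ },
    ?_, hcU, fun d hd v hv => ?_⟩
  · simpa [smul_add] using add_mem ha hb
  · simp [zero_mem]
  · simpa using ha
  · exact B.toAddGroupFilterBasis.mem_nhds_zero ⟨c, rfl⟩
  · have := hL d hd _ hv
    rwa [smul_comm] at this

theorem latticeFilterBasis_mem_nhds (L : AddSubgroup V)
    (hL : ∀ c : E, ‖c‖ ≤ 1 → ∀ v ∈ L, c • v ∈ L)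
    (habs : ∀ v : V, ∃ c : E, c ≠ 0 ∧ c • v ∈ L) :
    (L : Set V) ∈ @nhds V (latticeFilterBasis L hL habs).topology 0 :=
  (latticeFilterBasis L hL habs).toAddGroupFilterBasis.mem_nhds_zero ⟨1, by simp⟩

/-- Finite powers of locally convex spaces are locally convex. -/
theorem pi_mem_locallyConvexTopologies {V : Type*} [AddCommGroup V] [Module E V]
    [tV : TopologicalSpace V] (hV : tV ∈ locallyConvexTopologies E V) (r : ℕ) :
    (inferInstance : TopologicalSpace (Fin r → V)) ∈ locallyConvexTopologies E (Fin r → V) := by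
  have h1 := hV.1
  have h2 := hV.2.1
  refine ⟨inferInstance, inferInstance, ⟨fun U hU => ?_⟩⟩
  rw [nhds_pi, Filter.mem_pi] at hU
  obtain ⟨I, hI, W, hW, hWU⟩ := hU
  choose L hL1 hL2 hL3 using fun i => hV.2.2.exists_lattice (W i) (hW i)
  refine ⟨AddSubgroup.pi Set.univ L, ?_, fun v hv => hWU fun i _ => hL2 i (hv i trivial),
    fun c hc v hv i hi => hL3 i c hc _ (hv i hi)⟩
  exact set_pi_mem_nhds Set.finite_univ fun i _ => hL1 i

end Lattice

/-- The maps `ι m : X m → V` identify `V` with the locally convex inductive limit of the normed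
spaces `X m`, up to the kernels of the `ι m`. -/
structure IsNormedLimit (E : Type*) [NontriviallyNormedField E] {V : Type*} [AddCommGroup V]
    [Module E V] [tV : TopologicalSpace V] {X : ℕ → Type*} [∀ m, NormedAddCommGroup (X m)]
    [∀ m, NormedSpace E (X m)] (ι : ∀ m, X m →ₗ[E] V) : Prop where
  exists_mem : ∀ v, ∃ m, v ∈ Set.range (ι m)
  eq_sInf : tV = sInf {t | t ∈ locallyConvexTopologies E V ∧ ∀ m, Continuous[_, t] (ι m)}

section Limit

variable {E : Type*} [NontriviallyNormedField E] {V : Type*} [AddCommGroup V] [Module E V]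
  [tV : TopologicalSpace V] {X : ℕ → Type*} [∀ m, NormedAddCommGroup (X m)]
  [∀ m, NormedSpace E (X m)] {ι : ∀ m, X m →ₗ[E] V}

theorem IsNormedLimit.continuous_ι (h : IsNormedLimit E ι) (m : ℕ) : Continuous (ι m) := by
  rw [h.eq_sInf]
  exact continuous_sInf_rng.2 fun t ht => ht.2 m

/-- The universal property of the locally convex inductive limit. -/
theorem IsNormedLimit.continuous_of_comp (h : IsNormedLimit E ι) {Q : Type*} [AddCommGroup Q]
    [Module E Q] [tQ : TopologicalSpace Q] (hQ : tQ ∈ locallyConvexTopologies E Q)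
    (g : V →ₗ[E] Q) (hg : ∀ m, Continuous fun x => g (ι m x)) : Continuous g := by
  rw [continuous_iff_le_induced, h.eq_sInf]
  exact sInf_le ⟨locallyConvexTopologies_induced g hQ, fun m => continuous_induced_rng.2 (hg m)⟩

theorem IsNormedLimit.isTopologicalAddGroup (h : IsNormedLimit E ι) : IsTopologicalAddGroup V := by
  rw [h.eq_sInf]
  exact topologicalAddGroup_sInf fun _ ht => ht.1.1

/-- A lattice is open in the inductive limit if its preimage in every `X m` is open. -/
theorem IsNormedLimit.mem_nhds_zero (h : IsNormedLimit E ι) (L : AddSubgroup V)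
    (hL : ∀ c : E, ‖c‖ ≤ 1 → ∀ v ∈ L, c • v ∈ L) (hn : ∀ m, {x | ι m x ∈ L} ∈ 𝓝 (0 : X m)) :
    (L : Set V) ∈ 𝓝 0 := by
  -- `L` is absorbing: `v` comes from some `X m`, where small multiples of its preimage enter a
  -- neighbourhood of zero.
  have habs : ∀ v : V, ∃ c : E, c ≠ 0 ∧ c • v ∈ L := by
    intro v
    obtain ⟨m, x, rfl⟩ := h.exists_mem v
    have h1 : Filter.Tendsto (fun c : E => c • x) (𝓝[≠] 0) (𝓝 0) := by
      have : Filter.Tendsto (fun c : E => c • x) (𝓝 0) (𝓝 ((0 : E) • x)) :=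
        (continuous_id.smul continuous_const).tendsto 0
      rw [zero_smul] at this
      exact this.mono_left nhdsWithin_le_nhds
    obtain ⟨c, hc, hc0⟩ := (Filter.Eventually.and (h1.eventually (hn m)) self_mem_nhdsWithin).exists
    refine ⟨c, hc0, ?_⟩
    rw [← map_smul]
    exact hc
  have ht := latticeFilterBasis_mem L hL habs
  -- The topology defined by the multiples of `L` competes in the infimum, so `tV` is finer.
  have hle : tV ≤ (latticeFilterBasis L hL habs).topology := by
    rw [h.eq_sInf]
    refine sInf_le ⟨ht, fun m => ?_⟩
    let B := latticeFilterBasis L hL habs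
    let := B.topology
    have := B.isTopologicalAddGroup
    refine continuous_of_continuousAt_zero (ι m).toAddMonoidHom ?_
    rw [ContinuousAt, map_zero, B.toAddGroupFilterBasis.nhds_zero_hasBasis.tendsto_right_iff]
    rintro _ ⟨c, rfl⟩
    have h1 : Filter.Tendsto (fun x : X m => (c : E) • x) (𝓝 0) (𝓝 0) := by
      have : Filter.Tendsto (fun x : X m => (c : E) • x) (𝓝 0) (𝓝 ((c : E) • 0)) :=
        (continuous_const_smul (c : E)).tendsto 0
      rwa [smul_zero] at this
    filter_upwards [h1 (hn m)] with x hx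
    have hx' : ι m ((c : E) • x) ∈ L := hx
    rw [map_smul] at hx'
    exact hx'
  exact nhds_mono hle (latticeFilterBasis_mem_nhds L hL habs)

/-! ### Closed subsets of inductive limits along compact maps -/

section Compact

variable [∀ m, IsUltrametricDist (X m)]

/-- One step of the construction of an open lattice that avoids a given set. -/
theorem exists_compact_lattice {Y Z : Type*} [NormedAddCommGroup Y] [NormedSpace E Y]
    [IsUltrametricDist Y] [NormedAddCommGroup Z] [NormedSpace E Z] (j : Y →ₗ[E] Z)
    (hj : IsCompactOperator j) (K : AddSubgroup Y) (hK : IsCompact (K : Set Y))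
    (hKE : ∀ c : E, ‖c‖ ≤ 1 → ∀ v ∈ K, c • v ∈ K) (C : Set Z) (hC : IsClosed C)
    (hd : ∀ x ∈ K, j x ∉ C) :
    ∃ K' : AddSubgroup Z, IsCompact (K' : Set Z) ∧ (∀ c : E, ‖c‖ ≤ 1 → ∀ v ∈ K', c • v ∈ K') ∧
      (∀ x ∈ K', x ∉ C) ∧ (∀ x ∈ K, j x ∈ K') ∧ {x | j x ∈ K'} ∈ 𝓝 (0 : Y) := by
  -- The new lattice is `j K + D`, where `D` is the closure of the image of a small ball.
  -- Compactness of `j` makes `D` compact, and a small `D` keeps the sum away from `C`, since `j K`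
  -- is compact and disjoint from `C`.
  have hjc : Continuous j := hj.continuous
  have hjK : IsCompact (j '' K) := hK.image hjc
  obtain ⟨δ, hδ, hδC⟩ := hjK.exists_thickening_subset_open hC.isOpen_compl (by
    rintro _ ⟨x, hx, rfl⟩
    exact hd x hx)
  -- Half of `δ`, because taking the closure only preserves non-strict bounds.
  obtain ⟨ε, hε, hεδ⟩ := Metric.mem_nhds_iff.1
    (hjc.tendsto' 0 0 (map_zero j) (Metric.ball_mem_nhds (0 : Z) (half_pos hδ)))
  let U : AddSubgroup Y :=
    { carrier := Metric.ball 0 ε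
      zero_mem' := Metric.mem_ball_self hε
      add_mem' := fun {a b} ha hb => by
        rw [mem_ball_zero_iff] at *
        exact (IsUltrametricDist.norm_add_le_max a b).trans_lt (max_lt ha hb)
      neg_mem' := fun {a} ha => by simpa using ha }
  have hU : ∀ c : E, ‖c‖ ≤ 1 → ∀ v ∈ U, c • v ∈ U := fun c hc v hv => by
    change c • v ∈ Metric.ball 0 ε
    have hv' : v ∈ Metric.ball 0 ε := hv
    rw [mem_ball_zero_iff] at *
    rw [norm_smul]
    exact (mul_le_of_le_one_left (norm_nonneg _) hc).trans_lt hv'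
  let D : AddSubgroup Z := (U.map (j : Y →+ Z)).topologicalClosure
  have hD : IsCompact (D : Set Z) := hj.isCompact_closure_image_ball ε
  have hDE : ∀ c : E, ‖c‖ ≤ 1 → ∀ v ∈ D, c • v ∈ D := fun c hc v hv => by
    refine map_mem_closure (continuous_const_smul c) hv ?_
    rintro _ ⟨x, hx, rfl⟩
    exact ⟨c • x, hU c hc x hx, map_smul j c x⟩
  have hDδ : ∀ z ∈ D, ‖z‖ < δ := fun z hz => by
    have h1 : closure ((U.map (j : Y →+ Z) : AddSubgroup Z) : Set Z) ⊆
        Metric.closedBall 0 (δ / 2) := by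
      refine closure_minimal ?_ Metric.isClosed_closedBall
      rintro _ ⟨x, hx, rfl⟩
      exact Metric.ball_subset_closedBall (hεδ hx)
    have := h1 hz
    rw [mem_closedBall_zero_iff] at this
    linarith
  have hmem : ∀ z, z ∈ K.map (j : Y →+ Z) ⊔ D ↔ ∃ x ∈ K, ∃ d ∈ D, j x + d = z := by
    intro z
    rw [AddSubgroup.mem_sup]
    constructor
    · rintro ⟨_, ⟨x, hx, rfl⟩, d, hd, rfl⟩
      exact ⟨x, hx, d, hd, rfl⟩
    · rintro ⟨x, hx, d, hd, rfl⟩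
      exact ⟨_, ⟨x, hx, rfl⟩, d, hd, rfl⟩
  refine ⟨K.map (j : Y →+ Z) ⊔ D, ?_, fun c hc v hv => ?_, fun z hz hzC => ?_, fun x hx => ?_, ?_⟩
  · convert hjK.add hD using 1
    ext z
    rw [SetLike.mem_coe, hmem, Set.mem_add]
    constructor
    · rintro ⟨x, hx, d, hd, rfl⟩
      exact ⟨_, ⟨x, hx, rfl⟩, d, hd, rfl⟩
    · rintro ⟨_, ⟨x, hx, rfl⟩, d, hd, rfl⟩
      exact ⟨x, hx, d, hd, rfl⟩
  · rw [hmem] at hv ⊢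
    obtain ⟨x, hx, d, hd, rfl⟩ := hv
    exact ⟨c • x, hKE c hc x hx, c • d, hDE c hc d hd, by rw [smul_add, map_smul]⟩
  · obtain ⟨x, hx, d, hd, rfl⟩ := (hmem z).1 hz
    refine hδC (Metric.mem_thickening_iff.2 ⟨j x, ⟨x, hx, rfl⟩, ?_⟩) hzC
    rw [dist_eq_norm, add_sub_cancel_left]
    exact hDδ d hd
  · exact (hmem _).2 ⟨x, hx, 0, zero_mem _, add_zero _⟩
  · refine Filter.mem_of_superset (Metric.ball_mem_nhds 0 hε) fun x hx => (hmem _).2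
      ⟨0, zero_mem _, j x, ?_, by rw [map_zero, zero_add]⟩
    exact subset_closure ⟨x, hx, rfl⟩

/-- A subset of an inductive limit along compact maps is closed if its preimages are closed. -/
theorem IsNormedLimit.isClosed_of_preimage (h : IsNormedLimit E ι) (j : ∀ m, X m →ₗ[E] X (m + 1))
    (hj : ∀ m, IsCompactOperator (j m)) (hjι : ∀ m x, ι (m + 1) (j m x) = ι m x) (C : Set V)
    (hC : ∀ m, IsClosed (ι m ⁻¹' C)) : IsClosed C := by
  have := h.isTopologicalAddGroup
  rw [← isOpen_compl_iff, isOpen_iff_mem_nhds]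
  intro v hv
  obtain ⟨m₀, x₀, hx₀⟩ := h.exists_mem v
  -- After translation by `v`, it is enough to find an open lattice that misses `C'`.
  let C' : Set V := {w | v + w ∈ C}
  have hlift : ∀ m, m₀ ≤ m → v ∈ Set.range (ι m) := by
    intro m hm
    induction m, hm using Nat.le_induction with
    | base => exact ⟨x₀, hx₀⟩
    | succ m hm ih =>
      obtain ⟨x, hx⟩ := ih
      exact ⟨j m x, by rw [hjι, hx]⟩
  have hC'_of_le : ∀ m, m₀ ≤ m → IsClosed (ι m ⁻¹' C') := by
    intro m hm
    obtain ⟨x, hx⟩ := hlift m hm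
    have : ι m ⁻¹' C' = (fun y => x + y) ⁻¹' (ι m ⁻¹' C) := by
      ext y
      simp [C', hx]
    rw [this]
    exact (hC m).preimage (continuous_const.add continuous_id)
  have hjc : ∀ m, Continuous (j m) := fun m => (hj m).continuous
  have hC' : ∀ m, IsClosed (ι m ⁻¹' C') := by
    -- Descending induction: below `m₀` the vector `v` need not come from `X m`, but closedness
    -- pulls back along `j m`.
    have key : ∀ d m, m₀ ≤ m + d → IsClosed (ι m ⁻¹' C') := by
      intro d
      induction d with
      | zero => exact fun m hm => hC'_of_le m hm
      | succ d ih =>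
        intro m hm
        have h1 := (ih (m + 1) (by omega)).preimage (hjc m)
        convert h1 using 1
        ext x
        simp [hjι]
    exact fun m => key m₀ m (by omega)
  -- Starting from zero, compact lattices `K m` avoiding `C'` are built so that `j m` maps `K m`
  -- into `K (m + 1)`, whose preimage in `X m` is a neighbourhood of zero. The union of their images
  -- in `V` is the open lattice sought.
  let Good : ∀ m, AddSubgroup (X m) → Prop := fun m K =>
    IsCompact (K : Set (X m)) ∧ (∀ c : E, ‖c‖ ≤ 1 → ∀ v ∈ K, c • v ∈ K) ∧
      (∀ x ∈ K, x ∉ ι m ⁻¹' C')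
  have step : ∀ m (K : {K : AddSubgroup (X m) // Good m K}),
      ∃ K' : {K : AddSubgroup (X (m + 1)) // Good (m + 1) K}, (∀ x ∈ K.1, j m x ∈ K'.1) ∧
        {x | j m x ∈ K'.1} ∈ 𝓝 (0 : X m) := by
    rintro m ⟨K, hK1, hK2, hK3⟩
    obtain ⟨K', h1, h2, h3, h4, h5⟩ := exists_compact_lattice (j m) (hj m) K hK1 hK2 _
      (hC' (m + 1)) (fun x hx => by
        have := hK3 x hx
        simpa [hjι] using this)
    exact ⟨⟨K', h1, h2, h3⟩, h4, h5⟩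
  choose next hnext1 hnext2 using step
  have hbot : Good 0 ⊥ := by
    refine ⟨by simp, fun c _ v hv => ?_, fun x hx => ?_⟩
    · rw [AddSubgroup.mem_bot] at hv ⊢
      rw [hv, smul_zero]
    · rw [AddSubgroup.mem_bot] at hx
      simpa [hx, C'] using hv
  let K : ∀ m, {K : AddSubgroup (X m) // Good m K} := fun m => Nat.rec ⟨⊥, hbot⟩ next m
  have hK : ∀ m, K (m + 1) = next m (K m) := fun m => rfl
  let F : ℕ → AddSubgroup V := fun m => (K m).1.map (ι m : X m →+ V)
  have hF : Monotone F := by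
    refine monotone_nat_of_le_succ fun m => ?_
    rintro _ ⟨x, hx, rfl⟩
    refine ⟨j m x, ?_, hjι m x⟩
    rw [hK]
    exact hnext1 m (K m) x hx
  have hmem : ∀ w, w ∈ ⨆ m, F m ↔ ∃ m, w ∈ F m := fun w =>
    AddSubgroup.mem_iSup_of_directed hF.directed_le
  have hLn : ((⨆ m, F m : AddSubgroup V) : Set V) ∈ 𝓝 0 := by
    refine h.mem_nhds_zero _ (fun c hc w hw => ?_) fun m => ?_
    · rw [hmem] at hw ⊢
      obtain ⟨m, x, hx, rfl⟩ := hw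
      exact ⟨m, c • x, (K m).2.2.1 c hc x hx, map_smul (ι m) c x⟩
    -- `K m` itself need not be open in `X m`; the neighbourhood comes from stage `m + 1`.
    · refine Filter.mem_of_superset (hnext2 m (K m)) fun x hx => (hmem _).2 ⟨m + 1, j m x, ?_, ?_⟩
      · rw [hK]
        exact hx
      · exact hjι m x
  have hvL : (fun w => w - v) ⁻¹' ((⨆ m, F m : AddSubgroup V) : Set V) ∈ 𝓝 v := by
    refine (continuous_id.sub continuous_const).continuousAt.preimage_mem_nhds ?_
    simpa using hLn
  refine Filter.mem_of_superset hvL fun w hw hwC => ?_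
  obtain ⟨m, x, hx, hxw⟩ := (hmem _).1 hw
  refine (K m).2.2.2 x hx ?_
  have hxw' : ι m x = w - v := hxw
  simpa [C', hxw'] using hwC

end Compact

theorem continuous_sum_apply {V Q : Type*} [TopologicalSpace V] [AddCommGroup Q]
    [TopologicalSpace Q] [IsTopologicalAddGroup Q] {r : ℕ} {f : Fin r → V → Q}
    (hf : ∀ i, Continuous (f i)) : Continuous fun v : Fin r → V => ∑ i, f i (v i) :=
  continuous_finsetSum _ fun i _ => (hf i).comp (continuous_apply i)

/-- A finite power of an inductive limit is the inductive limit of the powers. -/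
theorem IsNormedLimit.pi (h : IsNormedLimit E ι) (j : ∀ m, X m →ₗ[E] X (m + 1))
    (hjι : ∀ m x, ι (m + 1) (j m x) = ι m x) (hV : tV ∈ locallyConvexTopologies E V) (r : ℕ) :
    IsNormedLimit E (fun m => (ι m).compLeft (Fin r)) where
  exists_mem v := by
    have hlift : ∀ w m₀, w ∈ Set.range (ι m₀) → ∀ m, m₀ ≤ m → w ∈ Set.range (ι m) := by
      rintro w m₀ hw m hm
      induction m, hm using Nat.le_induction with
      | base => exact hw
      | succ m hm ih =>
        obtain ⟨x, hx⟩ := ih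
        exact ⟨j m x, by rw [hjι, hx]⟩
    choose m hm using fun i => h.exists_mem (v i)
    choose x hx using fun i => hlift _ _ (hm i) (Finset.univ.sup m)
      (Finset.le_sup (Finset.mem_univ i))
    exact ⟨_, x, funext hx⟩
  eq_sInf := by
    refine le_antisymm (le_sInf ?_) (sInf_le ⟨?_, fun m => ?_⟩)
    · rintro t ⟨ht, htι⟩
      have := ht.1
      -- The identity of the power is the sum of the coordinate projections followed by the
      -- inclusions; the latter are continuous for `t` by the universal property of `V`.
      have h1 : ∀ i, Continuous[tV, t] (LinearMap.single E (fun _ : Fin r => V) i) := fun i =>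
        h.continuous_of_comp ht _ fun m => by
          have h2 : Continuous fun x : X m => (Pi.single i x : Fin r → X m) :=
            continuous_pi fun k => by
              by_cases hk : k = i
              · subst hk; simpa using continuous_id'
              · simpa [hk] using continuous_const
          refine ((htι m).comp h2).congr fun x => ?_
          ext k
          by_cases hk : k = i
          · subst hk; simp
          · simp [hk]
      have h2 := @continuous_sum_apply V (Fin r → V) _ _ t this r _ h1
      have h3 : (fun v : Fin r → V => ∑ i, LinearMap.single E (fun _ : Fin r => V) i (v i)) = id := by
        funext v
        exact LinearMap.sum_single_apply (fun _ : Fin r => V) v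
      rw [h3] at h2
      exact continuous_id_iff_le.1 h2
    · exact pi_mem_locallyConvexTopologies hV r
    · exact continuous_pi fun i => (h.continuous_ι m).comp (continuous_apply i)

theorem isCompactOperator_compLeft {Y Z : Type*} [NormedAddCommGroup Y] [NormedSpace E Y]
    [NormedAddCommGroup Z] [NormedSpace E Z] (j : Y →ₗ[E] Z) (hj : IsCompactOperator j) (r : ℕ) :
    IsCompactOperator (j.compLeft (Fin r)) := by
  obtain ⟨K, hK, hKj⟩ := hj
  refine ⟨Set.univ.pi fun _ => K, isCompact_univ_pi fun _ => hK, ?_⟩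
  exact set_pi_mem_nhds (x := (0 : Fin r → Y)) Set.finite_univ fun i _ => hKj

end Limit

/-! ### Submodules over Noetherian Banach algebras are closed -/

section NoetherianBanach

/-- The row sums bound the operator norm of `a` for the sup norm, so the Neumann series inverts `1 +
a`. -/
theorem isUnit_one_add_of_sum_norm_lt {R : Type*} [NormedRing R] [CompleteSpace R] {s : ℕ}
    (a : Matrix (Fin s) (Fin s) R) (ha : ∀ i, ∑ j, ‖a i j‖ < 1) : IsUnit (1 + a) := by
  let := Matrix.linftyOpNormedRing (n := Fin s) (α := R)
  have : @CompleteSpace (Matrix (Fin s) (Fin s) R) PseudoMetricSpace.toUniformSpace :=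
    inferInstanceAs (CompleteSpace (Fin s → Fin s → R))
  have h : ‖-a‖ < 1 := by
    rw [norm_neg, Matrix.linfty_opNorm_def]
    refine lt_of_lt_of_eq (b := ((1 : NNReal) : ℝ)) (NNReal.coe_lt_coe.2 ?_) NNReal.coe_one
    refine (Finset.sup_lt_iff (by simp)).2 fun i _ => ?_
    rw [← NNReal.coe_lt_coe]
    simpa using ha i
  have := (Units.oneSub (-a) h).isUnit
  rwa [Units.val_oneSub, sub_neg_eq_add] at this

variable (E : Type*) [NontriviallyNormedField E] {R : Type*} [NormedRing R] [NormedAlgebra E R]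
  [CompleteSpace R] [IsNoetherianRing R]

include E in
-- The closure of `N` has finitely many generators `e i` by Noetherianity. By the open mapping
-- theorem, each can be perturbed into `N` by a combination of the `e j` with small coefficients.
-- The resulting matrix `1 + a` is invertible, so the `e i` lie in `N`.
theorem isClosed_submodule_pi {r : ℕ} (N : Submodule R (Fin r → R)) :
    IsClosed (N : Set (Fin r → R)) := by
  let C : Submodule R (Fin r → R) := N.topologicalClosure
  have hCc : IsClosed (C : Set (Fin r → R)) := N.isClosed_topologicalClosure
  have : CompleteSpace C := hCc.completeSpace_coe
  obtain ⟨s, e, he⟩ := Submodule.fg_iff_exists_fin_generating_family.1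
    (IsNoetherian.noetherian C)
  have heC : ∀ i, e i ∈ C := fun i => he ▸ Submodule.subset_span ⟨i, rfl⟩
  let f₀ : (Fin s → R) →ₗ[R] C := Fintype.linearCombination R fun i => ⟨e i, heC i⟩
  have hf₀ : ∀ x, (f₀ x : Fin r → R) = ∑ i, x i • e i := fun x => by
    simp [f₀, Fintype.linearCombination_apply]
  have hcont : Continuous f₀ := by
    rw [continuous_induced_rng]
    refine Continuous.congr ?_ fun x => (hf₀ x).symm
    fun_prop
  let f : (Fin s → R) →L[E] (C.restrictScalars E) := ⟨f₀.restrictScalars E, hcont⟩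
  have hsurj : Function.Surjective f := by
    rintro ⟨y, hy⟩
    have hy' : y ∈ Submodule.span R (Set.range e) := he ▸ hy
    obtain ⟨x, hx⟩ := Submodule.mem_span_range_iff_exists_fun R |>.1 hy'
    exact ⟨x, Subtype.ext ((hf₀ x).trans hx)⟩
  have : CompleteSpace (C.restrictScalars E) := hCc.completeSpace_coe
  have hopen := f.isOpenMap hsurj
  let U : Set (Fin s → R) := {x | ∑ j, ‖x j‖ < 1}
  have hU : IsOpen U := isOpen_lt (by fun_prop) continuous_const
  have h0 : (0 : C.restrictScalars E) ∈ f '' U := ⟨0, by simp [U], map_zero f⟩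
  obtain ⟨W, hW, hWU⟩ := isOpen_induced_iff.1 (hopen U hU)
  -- `f '' U` is a neighbourhood of zero in `C`, and `N` is dense in `C`.
  have hap : ∀ i, ∃ x ∈ U, e i + ∑ j, x j • e j ∈ N := by
    intro i
    have hnhds : (fun y => y - e i) ⁻¹' W ∈ 𝓝 (e i) := by
      refine (hW.preimage (by fun_prop)).mem_nhds ?_
      have : (0 : C.restrictScalars E) ∈ Subtype.val ⁻¹' W := hWU ▸ h0
      simpa using this
    obtain ⟨y, hyW, hyN⟩ := mem_closure_iff_nhds.1 (heC i) _ hnhds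
    have hyC : y - e i ∈ C := sub_mem (N.le_topologicalClosure hyN) (heC i)
    have : (⟨y - e i, hyC⟩ : C.restrictScalars E) ∈ f '' U := hWU ▸ hyW
    obtain ⟨x, hx, hxy⟩ := this
    have hxy' : ∑ j, x j • e j = y - e i := (hf₀ x).symm.trans (congrArg Subtype.val hxy)
    exact ⟨x, hx, by rwa [hxy', add_sub_cancel]⟩
  choose a haU haN using hap
  obtain ⟨b, hb⟩ := (isUnit_one_add_of_sum_norm_lt (Matrix.of a) haU).exists_left_inv
  have hmem : ∀ k, e k ∈ N := by
    intro k
    have h1 : ∑ i, b k i • (e i + ∑ j, a i j • e j) = e k := by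
      have h2 : ∀ j, ∑ i, b k i * ((1 : Matrix (Fin s) (Fin s) R) i j + a i j) =
          (1 : Matrix (Fin s) (Fin s) R) k j := fun j => by
        exact (Matrix.mul_apply (M := b) (N := 1 + Matrix.of a)).symm.trans (by rw [hb])
      calc _ = ∑ i, b k i • ∑ j, ((1 : Matrix (Fin s) (Fin s) R) i j + a i j) • e j := by
            refine Finset.sum_congr rfl fun i _ => ?_
            simp [add_smul, Finset.sum_add_distrib, Matrix.one_apply]
        _ = ∑ j, (∑ i, b k i * ((1 : Matrix (Fin s) (Fin s) R) i j + a i j)) • e j := by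
            simp only [Finset.smul_sum, smul_smul, Finset.sum_smul]
            exact Finset.sum_comm
        _ = e k := by simp only [h2]; simp [Matrix.one_apply]
    rw [← h1]
    exact sum_mem fun i _ => N.smul_mem _ (haN i)
  have hCN : C ≤ N := he ▸ Submodule.span_le.2 (by rintro _ ⟨k, rfl⟩; exact hmem k)
  have : N = C := le_antisymm N.le_topologicalClosure hCN
  rw [this]
  exact hCc

end NoetherianBanach

/-- Submodules of finite free modules over an algebra of compact type are closed. -/
theorem IsCompactTypeAlgebra.isClosed_submodule_pi {E C : Type*} [NontriviallyNormedField E]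
    [Ring C] [Algebra E C] [tC : TopologicalSpace C] (hC : IsCompactTypeAlgebra E C)
    (hlc : tC ∈ locallyConvexTopologies E C) {r : ℕ} (N : Submodule C (Fin r → C)) :
    IsClosed (N : Set (Fin r → C)) := by
  obtain ⟨X, _, _, _, _, _, j, ι, hj, hjι, -, hmem, htC⟩ := hC
  have hlim : IsNormedLimit E fun m => (ι m).toLinearMap := ⟨hmem, htC⟩
  refine (hlim.pi (fun m => (j m).toLinearMap) hjι hlc r).isClosed_of_preimage
    (fun m => (j m).toLinearMap.compLeft (Fin r))
    (fun m => isCompactOperator_compLeft _ (hj m) r) (fun m x => funext fun i => hjι m (x i)) _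
    fun m => ?_
  -- The preimage of `N` at step `m` is a submodule over the Noetherian Banach algebra `X m`.
  let N' : Submodule (X m) (Fin r → X m) :=
    { carrier := {x | (fun i => ι m (x i)) ∈ N}
      zero_mem' := by
        have : (fun i => ι m ((0 : Fin r → X m) i)) = 0 := by ext; simp
        simpa only [Set.mem_ofPred_eq, this] using N.zero_mem
      add_mem' := fun {x y} hx hy => by
        have : (fun i => ι m ((x + y) i)) = (fun i => ι m (x i)) + fun i => ι m (y i) := by
          ext; simp
        simpa only [Set.mem_ofPred_eq, this] using add_mem hx hy
      smul_mem' := fun c x hx => by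
        have : (fun i => ι m ((c • x) i)) = ι m c • fun i => ι m (x i) := by ext; simp
        simpa only [Set.mem_ofPred_eq, this] using N.smul_mem _ hx }
  exact FrechetStein.isClosed_submodule_pi E N'

/-! ### Open mapping and closed graph -/

section OpenMapping

variable {E : Type*} [NontriviallyNormedField E]

/-- A continuous linear map between ultrametric Banach spaces is open as soon as the closure of the
image of a ball has an interior point. -/
theorem image_mem_nhds_zero_of_interior_nonempty {W Y : Type*} [NormedAddCommGroup W]
    [NormedSpace E W] [IsUltrametricDist W] [CompleteSpace W] [NormedAddCommGroup Y]
    [NormedSpace E Y] (p : W →L[E] Y) {r : ℝ}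
    (h : (interior (closure (p '' Metric.ball 0 r))).Nonempty) {U : Set W} (hU : U ∈ 𝓝 0) :
    p '' U ∈ 𝓝 0 := by
  have hr : 0 < r := by
    by_contra hr
    rw [Metric.ball_eq_empty.2 (not_lt.1 hr)] at h
    simp at h
  let B : AddSubgroup W :=
    { carrier := Metric.ball 0 r
      zero_mem' := Metric.mem_ball_self hr
      add_mem' := fun {a b} ha hb => by
        rw [mem_ball_zero_iff] at *
        exact (IsUltrametricDist.norm_add_le_max a b).trans_lt (max_lt ha hb)
      neg_mem' := fun {a} ha => by simpa using ha }
  -- In the ultrametric setting balls are subgroups, and a subgroup that is a neighbourhood of one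
  -- of its points is open.
  let G : AddSubgroup Y := (B.map (p : W →+ Y)).topologicalClosure
  have hG : (G : Set Y) ∈ 𝓝 0 := by
    obtain ⟨y, hy⟩ := h
    exact (G.isOpen_of_mem_nhds (mem_interior_iff_mem_nhds.1 hy)).mem_nhds (zero_mem G)
  obtain ⟨δ, hδ, hδG⟩ := Metric.mem_nhds_iff.1 hG
  obtain ⟨c, hc0, hc1⟩ := NormedField.exists_norm_lt_one E
  have hc : c ≠ 0 := norm_pos_iff.1 hc0
  -- Successive approximation: the error, rescaled by `c⁻¹`, lies again in the `δ`-ball. Iterating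
  -- writes `y` as the image of a series `∑ c ^ k • x_k`.
  have step : ∀ y : Metric.ball (0 : Y) δ, ∃ (x : W) (y' : Metric.ball (0 : Y) δ),
      ‖x‖ < r ∧ (y : Y) = p x + c • (y' : Y) := by
    rintro ⟨y, hy⟩
    obtain ⟨_, ⟨x, hx, rfl⟩, hxy⟩ := Metric.mem_closure_iff.1 (hδG hy) (‖c‖ * δ) (by positivity)
    refine ⟨x, ⟨c⁻¹ • (y - p x), ?_⟩, ?_, ?_⟩
    · rw [mem_ball_zero_iff, norm_smul, norm_inv, inv_mul_lt_iff₀ hc0, ← dist_eq_norm]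
      exact hxy
    · exact mem_ball_zero_iff.1 hx
    · rw [smul_inv_smul₀ hc, add_sub_cancel]
  choose x next hx hnext using step
  have key : ∀ y ∈ Metric.ball (0 : Y) δ, ∃ w, ‖w‖ ≤ r * (1 - ‖c‖)⁻¹ ∧ p w = y := by
    intro y hy
    let Z : ℕ → Metric.ball (0 : Y) δ := fun k => next^[k] ⟨y, hy⟩
    have hbound : ∀ k, ‖c ^ k • x (Z k)‖ ≤ r * ‖c‖ ^ k := fun k => by
      rw [norm_smul, norm_pow, mul_comm]
      exact mul_le_mul_of_nonneg_right (hx _).le (by positivity)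
    have hgeo : HasSum (fun k => r * ‖c‖ ^ k) (r * (1 - ‖c‖)⁻¹) :=
      (hasSum_geometric_of_lt_one (norm_nonneg c) hc1).mul_left r
    have hsum : Summable fun k => c ^ k • x (Z k) :=
      Summable.of_norm_bounded hgeo.summable hbound
    refine ⟨∑' k, c ^ k • x (Z k), tsum_of_norm_bounded hgeo hbound, ?_⟩
    have hpart : ∀ n, p (∑ k ∈ Finset.range n, c ^ k • x (Z k)) = y - c ^ n • (Z n : Y) := by
      intro n
      induction n with
      | zero => simp [Z]
      | succ n ih =>
        rw [Finset.sum_range_succ, map_add, ih, map_smul]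
        have h1 : Z (n + 1) = next (Z n) := Function.iterate_succ_apply' next n _
        have h2 := hnext (Z n)
        rw [← h1] at h2
        rw [pow_succ, mul_smul]
        nth_rewrite 1 [h2]
        rw [smul_add]
        abel
    have h1 : Filter.Tendsto (fun n => p (∑ k ∈ Finset.range n, c ^ k • x (Z k))) Filter.atTop
        (𝓝 (p (∑' k, c ^ k • x (Z k)))) :=
      (p.continuous.tendsto _).comp hsum.hasSum.tendsto_sum_nat
    have h2 : Filter.Tendsto (fun n => y - c ^ n • (Z n : Y)) Filter.atTop (𝓝 (y - 0)) := by
      refine tendsto_const_nhds.sub (squeeze_zero_norm (a := fun n => ‖c‖ ^ n * δ) (fun n => ?_) ?_)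
      · rw [norm_smul, norm_pow]
        exact mul_le_mul_of_nonneg_left (mem_ball_zero_iff.1 (Z n).2).le (by positivity)
      · simpa using (tendsto_pow_atTop_nhds_zero_of_lt_one (norm_nonneg c) hc1).mul_const δ
    simp only [hpart] at h1
    simpa using tendsto_nhds_unique h1 h2
  obtain ⟨ε, hε, hεU⟩ := Metric.mem_nhds_iff.1 hU
  have hR : 0 < r * (1 - ‖c‖)⁻¹ := mul_pos hr (inv_pos.2 (sub_pos.2 hc1))
  obtain ⟨d, hd0, hdε⟩ := NormedField.exists_norm_lt E (div_pos hε hR)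
  have hd : d ≠ 0 := norm_pos_iff.1 hd0
  refine Filter.mem_of_superset (Metric.ball_mem_nhds (0 : Y) (mul_pos hd0 hδ)) fun y hy => ?_
  obtain ⟨w, hw, hwy⟩ := key (d⁻¹ • y) (by
    rw [mem_ball_zero_iff] at hy ⊢
    rwa [norm_smul, norm_inv, inv_mul_lt_iff₀ hd0])
  refine ⟨d • w, hεU ?_, by rw [map_smul, hwy, smul_inv_smul₀ hd]⟩
  rw [mem_ball_zero_iff, norm_smul]
  calc ‖d‖ * ‖w‖ ≤ ‖d‖ * (r * (1 - ‖c‖)⁻¹) := mul_le_mul_of_nonneg_left hw hd0.le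
    _ < ε := (lt_div_iff₀ hR).1 hdε

/-- If a Banach space is covered by the images of a sequence of Banach spaces, then the continuity
of a linear map on it can be tested after composition with these maps. -/
theorem continuous_of_iUnion_range {Y : Type*} [NormedAddCommGroup Y] [NormedSpace E Y]
    [CompleteSpace Y] {W : ℕ → Type*} [∀ l, NormedAddCommGroup (W l)]
    [∀ l, NormedSpace E (W l)] [∀ l, IsUltrametricDist (W l)] [∀ l, CompleteSpace (W l)]
    (p : ∀ l, W l →L[E] Y) (hp : ∀ y, ∃ l, y ∈ Set.range (p l)) {Q : Type*} [AddCommGroup Q]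
    [Module E Q] [TopologicalSpace Q] [IsTopologicalAddGroup Q] (u : Y →ₗ[E] Q)
    (hu : ∀ l, Continuous fun w => u (p l w)) : Continuous u := by
  -- Baire's theorem on a countable cover, with balls of integer radius.
  have hcover : ⋃ x : ℕ × ℕ, closure (p x.1 '' Metric.ball 0 x.2) = Set.univ := by
    refine Set.eq_univ_of_forall fun y => ?_
    obtain ⟨l, w, rfl⟩ := hp y
    obtain ⟨n, hn⟩ := exists_nat_gt ‖w‖
    exact Set.mem_iUnion.2 ⟨(l, n), subset_closure ⟨w, mem_ball_zero_iff.2 hn, rfl⟩⟩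
  obtain ⟨⟨l, n⟩, hne⟩ := nonempty_interior_of_iUnion_of_closed (fun _ => isClosed_closure) hcover
  refine continuous_of_continuousAt_zero u.toAddMonoidHom fun U hU => ?_
  have h1 : (fun w => u (p l w)) ⁻¹' U ∈ 𝓝 (0 : W l) :=
    (hu l).continuousAt.preimage_mem_nhds (by simpa using hU)
  refine Filter.mem_map.2
    (Filter.mem_of_superset (image_mem_nhds_zero_of_interior_nonempty (p l) hne h1) ?_)
  rintro _ ⟨w, hw, rfl⟩
  exact hw

/-- A linear map on a space `M` of compact type is continuous if its composition with a continuous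
surjection onto `M` from a limit of a sequence of Banach spaces is. -/
theorem IsCompactTypeSpace.continuous_of_comp {M : Type*} [AddCommGroup M] [Module E M]
    [TopologicalSpace M] [T2Space M] (hM : IsCompactTypeSpace E M) {V : Type*} [AddCommGroup V]
    [Module E V] [TopologicalSpace V] {X : ℕ → Type*} [∀ m, NormedAddCommGroup (X m)]
    [∀ m, NormedSpace E (X m)] [∀ m, IsUltrametricDist (X m)] [∀ m, CompleteSpace (X m)]
    {ι : ∀ m, X m →ₗ[E] V} (hV : IsNormedLimit E ι) (f : V →ₗ[E] M) (hf : Continuous f)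
    (hsurj : Function.Surjective f) {Q : Type*} [AddCommGroup Q] [Module E Q]
    [tQ : TopologicalSpace Q] (hQ : tQ ∈ locallyConvexTopologies E Q) (g : M →ₗ[E] Q)
    (hgf : Continuous fun v => g (f v)) : Continuous g := by
  obtain ⟨Y, _, _, _, _, j, κ, hj, hjκ, -, hmem, htM⟩ := hM
  have hlim : IsNormedLimit E κ := ⟨hmem, htM⟩
  have := hQ.1
  refine hlim.continuous_of_comp hQ g fun m => ?_
  -- The fibre product of `Y m` and `X l` over `M` is closed because `M` is Hausdorff, hence Banach.
  -- Its projections to `Y m` cover `Y m` as `l` varies, since `f` is surjective, and on it `g ∘ κ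
  -- m` agrees with the continuous map `g ∘ f ∘ ι l`.
  let W : ∀ l, Submodule E (Y m × X l) := fun l =>
    LinearMap.eqLocus ((κ m).comp (LinearMap.fst E _ _)) ((f.comp (ι l)).comp (LinearMap.snd E _ _))
  have hWc : ∀ l, IsClosed (W l : Set (Y m × X l)) := fun l =>
    isClosed_eq ((hlim.continuous_ι m).comp continuous_fst)
      ((hf.comp (hV.continuous_ι l)).comp continuous_snd)
  have : ∀ l, CompleteSpace (W l) := fun l => (hWc l).completeSpace_coe
  have : ∀ l, IsUltrametricDist (Y m × X l) := fun l => ⟨fun x y z => by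
    simp only [Prod.dist_eq]
    have h1 := dist_triangle_max x.1 y.1 z.1
    have h2 := dist_triangle_max x.2 y.2 z.2
    exact max_le (h1.trans (max_le_max (le_max_left _ _) (le_max_left _ _)))
      (h2.trans (max_le_max (le_max_right _ _) (le_max_right _ _)))⟩
  have : ∀ l, IsUltrametricDist (W l) := fun l => IsUltrametricDist.subtype _
  refine continuous_of_iUnion_range (W := fun l => W l)
    (fun l => (ContinuousLinearMap.fst E _ _).comp (W l).subtypeL) (fun y => ?_)
    (g.comp (κ m)) fun l => ?_
  · obtain ⟨v, hv⟩ := hsurj (κ m y)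
    obtain ⟨l, x, rfl⟩ := hV.exists_mem v
    exact ⟨l, ⟨(y, x), hv.symm⟩, rfl⟩
  · refine (hgf.comp ((hV.continuous_ι l).comp (continuous_snd.comp continuous_subtype_val))).congr
      fun w => ?_
    exact congrArg g w.2.symm

/-- Quotients of locally convex spaces are locally convex. -/
theorem quotient_mem_locallyConvexTopologies {V : Type*} [AddCommGroup V] [Module E V]
    [tV : TopologicalSpace V] (hV : tV ∈ locallyConvexTopologies E V) {C : Type*} [Ring C]
    [Algebra E C] [Module C V] [IsScalarTower E C V] (N : Submodule C V) :
    (inferInstance : TopologicalSpace (V ⧸ N)) ∈ locallyConvexTopologies E (V ⧸ N) := by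
  have := hV.1
  have := hV.2.1
  refine ⟨inferInstance, ⟨?_⟩, ⟨fun U hU => ?_⟩⟩
  · rw [← (IsOpenQuotientMap.id.prodMap N.isOpenQuotientMap_mkQ).continuous_comp_iff]
    exact N.continuous_mkQ.comp (continuous_smul (M := E) (X := V))
  · have hU' : N.mkQ ⁻¹' U ∈ 𝓝 (0 : V) :=
      N.continuous_mkQ.continuousAt.preimage_mem_nhds (by simpa using hU)
    obtain ⟨L, hL1, hL2, hL3⟩ := hV.2.2.exists_lattice _ hU'
    refine ⟨L.map N.mkQ.toAddMonoidHom, ?_, ?_, ?_⟩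
    · simpa using N.isOpenQuotientMap_mkQ.isOpenMap.image_mem_nhds hL1
    · rintro _ ⟨v, hv, rfl⟩
      exact hL2 hv
    · rintro c hc _ ⟨v, hv, rfl⟩
      exact ⟨c • v, hL3 c hc v hv, rfl⟩

end OpenMapping

/-! ### Base change between algebras of compact type -/

section CompactType

variable {E : Type*} [NontriviallyNormedField E]
variable {C : Type*} [Ring C] [Algebra E C] [tC : TopologicalSpace C]
variable {P : Type*} [AddCommGroup P] [Module E P] [Module C P] [IsScalarTower E C P]
  [TopologicalSpace P]

theorem apply_eq_sum_single {C P : Type*} [Ring C] [AddCommGroup P] [Module C P] {r : ℕ}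
    (f : (Fin r → C) →ₗ[C] P) (x : Fin r → C) : f x = ∑ i, x i • f (Pi.single i 1) := by
  simp_rw [← map_smul, ← map_sum]
  congr 1
  ext i
  simp [Finset.sum_apply, Pi.single_apply]

/-- A linear map on a finitely generated module with its canonical topology is continuous if its
composition with a presentation is. -/
theorem IsCompactTypeAlgebra.continuous_of_comp (hC : IsCompactTypeAlgebra E C)
    (hlc : tC ∈ locallyConvexTopologies E C) [ContinuousSMul C P] [T2Space P]
    (hP : IsCompactTypeSpace E P) {r : ℕ} (f : (Fin r → C) →ₗ[C] P)
    (hsurj : Function.Surjective f) {Q : Type*} [AddCommGroup Q] [Module E Q]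
    [tQ : TopologicalSpace Q] (hQ : tQ ∈ locallyConvexTopologies E Q) (g : P →ₗ[E] Q)
    (hgf : Continuous fun v => g (f v)) : Continuous g := by
  have hPadd : IsTopologicalAddGroup P := by
    obtain ⟨Y, _, _, _, _, j, κ, hj, hjκ, -, hmem, htM⟩ := hP
    exact IsNormedLimit.isTopologicalAddGroup (ι := κ) ⟨hmem, htM⟩
  have hf : Continuous f := by
    refine Continuous.congr (f := fun x : Fin r → C => ∑ i, x i • f (Pi.single i 1)) ?_ fun x => ?_
    · exact continuous_finsetSum _ fun i _ => (continuous_apply i).smul continuous_const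
    · exact (apply_eq_sum_single f x).symm
  obtain ⟨X, _, _, _, _, _, j, ι, hj, hjι, -, hmem, htC⟩ := hC
  have hlim : IsNormedLimit E fun m => (ι m).toLinearMap := ⟨hmem, htC⟩
  exact hP.continuous_of_comp (hlim.pi (fun m => (j m).toLinearMap) hjι hlc r)
    (f.restrictScalars E) hf hsurj hQ g hgf

/-- Submodules of finitely generated modules with their canonical topology are closed. -/
theorem IsCompactTypeAlgebra.isClosed_submodule (hC : IsCompactTypeAlgebra E C)
    (hlc : tC ∈ locallyConvexTopologies E C) [ContinuousSMul C P] [T2Space P]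
    [Module.Finite C P] (hP : IsCompactTypeSpace E P) (N : Submodule C P) :
    IsClosed (N : Set P) := by
  obtain ⟨r, f, hf⟩ := Module.Finite.exists_fin' C P
  let N' := N.comap f
  have hN' : IsClosed (N' : Set (Fin r → C)) := hC.isClosed_submodule_pi hlc N'
  have hker : LinearMap.ker f ≤ LinearMap.ker N'.mkQ := fun x hx => by
    rw [Submodule.ker_mkQ]
    change f x ∈ N
    rw [LinearMap.mem_ker.1 hx]
    exact N.zero_mem
  -- This map has kernel `N` and a Hausdorff target. Its composition with the presentation `f` is
  -- the quotient map, which gives its continuity.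
  let g : P →ₗ[C] (Fin r → C) ⧸ N' :=
    ((LinearMap.ker f).liftQ N'.mkQ hker).comp (f.quotKerEquivOfSurjective hf).symm.toLinearMap
  have hg : ∀ x, g (f x) = N'.mkQ x := fun x => by
    have : (f.quotKerEquivOfSurjective hf).symm (f x) = Submodule.Quotient.mk x := by
      rw [LinearEquiv.symm_apply_eq]
      rfl
    simp [g, this]
  have hcont : Continuous (g.restrictScalars E) := by
    refine hC.continuous_of_comp hlc hP f hf
      (quotient_mem_locallyConvexTopologies (pi_mem_locallyConvexTopologies hlc r) N') _ ?_
    exact N'.continuous_mkQ.congr fun x => (hg x).symm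
  have : (N : Set P) = g.restrictScalars E ⁻¹' {0} := by
    ext y
    obtain ⟨x, rfl⟩ := hf y
    simp only [Set.mem_preimage, Set.mem_singleton_iff, LinearMap.restrictScalars_apply, hg]
    exact (Submodule.Quotient.mk_eq_zero N').symm
  rw [this]
  have := hlc.1
  exact isClosed_singleton.preimage hcont

variable {D : Type*} [Ring D] [Algebra E D] [tD : TopologicalSpace D] [IsTopologicalRing D]

/-- The base change of a finitely generated module with its canonical topology, along a continuous
homomorphism of algebras of compact type, is Hausdorff. -/
theorem BaseChange.t2Space (hC : IsCompactTypeAlgebra E C)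
    (hlc : tC ∈ locallyConvexTopologies E C) (hD : IsCompactTypeAlgebra E D)
    (hDlc : tD ∈ locallyConvexTopologies E D) (τ : C →ₐ[E] D) (hτ : Continuous τ)
    [ContinuousSMul C P] [T2Space P] [Module.Finite C P] (hP : IsCompactTypeSpace E P) :
    T2Space (BaseChange τ P) := by
  obtain ⟨r, f, hf⟩ := Module.Finite.exists_fin' C P
  -- A presentation of `P` induces one of its base change. The target will be compared with `(Fin r
  -- → D) ⧸ ker F`, which is Hausdorff since `ker F` is closed.
  let F : (Fin r → D) →ₗ[D] BaseChange τ P :=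
    Fintype.linearCombination D fun i => tmul τ 1 (f (Pi.single i 1))
  have hFf : ∀ x, F (fun i => τ (x i)) = tmul τ 1 (f x) := fun x => by
    rw [apply_eq_sum_single f x]
    change _ = unit τ P _
    rw [map_sum, Fintype.linearCombination_apply]
    refine Finset.sum_congr rfl fun i _ => ?_
    rw [map_smulₛₗ]
    rfl
  have hF : Function.Surjective F := by
    intro y
    induction y using BaseChange.induction_on with
    | zero => exact ⟨0, map_zero F⟩
    | tmul s m =>
      obtain ⟨x, rfl⟩ := hf m
      exact ⟨s • fun i => τ (x i), by rw [map_smul, hFf, smul_one_tmul]⟩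
    | add x y hx hy =>
      obtain ⟨a, rfl⟩ := hx
      obtain ⟨b, rfl⟩ := hy
      exact ⟨a + b, map_add F a b⟩
  let N := LinearMap.ker F
  have hN : IsClosed (N : Set (Fin r → D)) := hD.isClosed_submodule_pi hDlc N
  have hQ := quotient_mem_locallyConvexTopologies (pi_mem_locallyConvexTopologies hDlc r) N
  let e : ((Fin r → D) ⧸ N) ≃ₗ[D] BaseChange τ P := F.quotKerEquivOfSurjective hF
  have he : ∀ x, e.symm (F x) = N.mkQ x := fun x => by
    rw [LinearEquiv.symm_apply_eq]
    rfl
  let h : P →ₗ[E] (Fin r → D) ⧸ N :=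
    (e.symm.toLinearMap.restrictScalars E).comp (restrict τ (unit τ P))
  have hh : Continuous h := by
    refine hC.continuous_of_comp hlc hP f hf hQ h ?_
    have h1 : Continuous fun x : Fin r → C => N.mkQ fun i => τ (x i) :=
      N.continuous_mkQ.comp (continuous_pi fun i => hτ.comp (continuous_apply i))
    refine h1.congr fun x => ?_
    rw [← he, hFf]
    rfl
  -- By the definition of the projective topology, it suffices that `(d, x) ↦ d • h x` is jointly
  -- continuous.
  have hcont : Continuous e.symm := by
    refine continuous_coinduced_dom.2 ?_
    refine continuous_iff_le_induced.2 (sInf_le ⟨?_, ?_⟩)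
    · exact locallyConvexTopologies_induced
        ((e.symm.toLinearMap.restrictScalars E).comp ((mk τ P).restrictScalars E)) hQ
    · refine continuous_induced_rng.2 ?_
      have h1 : Continuous fun x : D × P => x.1 • h x.2 :=
        continuous_fst.smul (hh.comp continuous_snd)
      refine h1.congr fun x => ?_
      change x.1 • e.symm (tmul τ 1 x.2) = e.symm (tmul τ x.1 x.2)
      rw [← map_smul, smul_one_tmul]
  exact T2Space.of_injective_continuous e.symm.injective hcont

end CompactType

/-- In a coadmissible sequence over algebras of compact type, where the modules carry their
canonical topology, the uncompleted base change of `N (n + 1)` is `N n`. -/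
theorem isBaseChangeMap_of_completed {E : Type*} [NontriviallyNormedField E]
    {C : Type*} [Ring C] [Algebra E C] [tC : TopologicalSpace C] [IsTopologicalRing C]
    {D : Type*} [Ring D] [Algebra E D] [tD : TopologicalSpace D] [IsTopologicalRing D]
    (hC : IsCompactTypeAlgebra E C) (hlc : tC ∈ locallyConvexTopologies E C)
    (hD : IsCompactTypeAlgebra E D) (hDlc : tD ∈ locallyConvexTopologies E D)
    (τ : C →ₐ[E] D) (hτ : Continuous τ)
    {P : Type*} [AddCommGroup P] [Module E P] [Module C P] [IsScalarTower E C P]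
    [TopologicalSpace P] [ContinuousSMul C P] [T2Space P] [Module.Finite C P]
    (hP : IsCompactTypeSpace E P)
    {N : Type*} [AddCommGroup N] [Module E N] [Module D N] [IsScalarTower E D N]
    [TopologicalSpace N] [ContinuousSMul D N] [T2Space N] [Module.Finite D N]
    (hN : IsCompactTypeSpace E N) (e : CompletedBaseChange τ P ≃L[D] N)
    (t : P →ₛₗ[(τ : C →+* D)] N)
    (ht : ∀ x, t x = e ((BaseChange.tmul τ 1 x : BaseChange τ P) : CompletedBaseChange τ P)) :
    IsBaseChangeMap τ t := by
  have := BaseChange.t2Space hC hlc hD hDlc τ hτ hP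
  have hlift : ∀ x : BaseChange τ P, BaseChange.lift τ t x = e (x : CompletedBaseChange τ P) := by
    intro x
    induction x using BaseChange.induction_on with
    | zero => rw [map_zero, UniformSpace.Completion.coe_zero, map_zero]
    | tmul s m =>
      rw [BaseChange.lift_tmul, ht, ← map_smul, ← UniformSpace.Completion.coe_smul,
        BaseChange.smul_one_tmul]
    | add x y hx hy => rw [map_add, hx, hy, UniformSpace.Completion.coe_add, map_add]
  constructor
  -- A Hausdorff space embeds in its completion.
  · intro x y hxy
    rw [hlift, hlift] at hxy
    exact UniformSpace.Completion.coe_injective _ (e.injective hxy)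
  -- The range is a `D`-submodule, hence closed, and it is dense.
  · have hcl := hD.isClosed_submodule hDlc hN (LinearMap.range (BaseChange.lift τ t))
    have hdense : DenseRange (BaseChange.lift τ t) := by
      have h1 : DenseRange fun x : BaseChange τ P => e (x : CompletedBaseChange τ P) :=
        e.surjective.denseRange.comp UniformSpace.Completion.denseRange_coe e.continuous
      rwa [← funext hlift] at h1
    rw [← Set.range_eq_univ]
    have h2 := hdense.closure_range
    rwa [← LinearMap.coe_range, hcl.closure_eq] at h2

/-! ### The Mittag-Leffler argument -/

section MittagLeffler

open Filter

/-- Mittag-Leffler: the projective limit of a sequence of complete normed groups with dense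
transition maps has dense image in every term. -/
theorem exists_compatible_dist_lt {G : ℕ → Type*} [∀ n, NormedAddCommGroup (G n)]
    [∀ n, CompleteSpace (G n)] (t : ∀ n, G (n + 1) → G n) (ht : ∀ n, Continuous (t n))
    (hd : ∀ n, DenseRange (t n)) (k : ℕ) (x₀ : G k) {ε : ℝ} (hε : 0 < ε) :
    ∃ y : ∀ n, G n, (∀ n, t n (y (n + 1)) = y n) ∧ dist (y k) x₀ < ε := by
  -- Density provides `z'` with image so close to `z` that the images in all of the finitely many
  -- lower terms are close as well.
  have step : ∀ (l : ℕ) (z : G (k + l)), ∃ z' : G (k + (l + 1)), ∀ i (h : i ≤ k + l),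
      dist (transition t h z) (transition t h (t (k + l) z')) < ε / 4 * (1 / 2) ^ l := by
    intro l z
    have hev : ∀ᶠ w in 𝓝 z, ∀ i ∈ Set.Iic (k + l), ∀ h : i ≤ k + l,
        dist (transition t h z) (transition t h w) < ε / 4 * (1 / 2) ^ l := by
      refine (eventually_all_finite (Set.finite_Iic _)).2 fun i hi => ?_
      have h1 : Tendsto (fun w => dist (transition t hi z) (transition t hi w)) (𝓝 z) (𝓝 0) := by
        have : Continuous fun w => dist (transition t hi z) (transition t hi w) :=
          continuous_const.dist (continuous_transition t ht hi)
        simpa using this.tendsto z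
      filter_upwards [h1.eventually_lt_const (show 0 < ε / 4 * (1 / 2) ^ l by positivity)]
        with w hw _
      exact hw
    obtain ⟨_, hw, z', rfl⟩ := mem_closure_iff_nhds.1 (hd (k + l) z) _ hev
    exact ⟨z', fun i h => hw i h h⟩
  choose next hnext using step
  let x : ∀ l, G (k + l) := fun l => Nat.rec x₀ next l
  -- The image of `x l` in `G i`; the default value concerns finitely many `l` and does not affect
  -- the limit.
  let w : ∀ i, ℕ → G i := fun i l => if h : i ≤ k + l then transition t h (x l) else 0
  have hw : ∀ i l (h : i ≤ k + l), w i l = transition t h (x l) := fun i l h => dif_pos h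
  have hdist : ∀ i l, i ≤ k + l → dist (w i l) (w i (l + 1)) ≤ ε / 4 * (1 / 2) ^ l := by
    intro i l h
    rw [hw i l h, hw i (l + 1) (h.trans (Nat.le_succ _)), transition_succ t h]
    exact (hnext l (x l) i h).le
  have hlim : ∀ i, ∃ y, Tendsto (w i) atTop (𝓝 y) := by
    intro i
    have hc : CauchySeq fun l => w i (l + i) := by
      refine cauchySeq_of_le_geometric (1 / 2) (ε / 4) (by norm_num) fun l => ?_
      have := hdist i (l + i) (by omega)
      rw [show l + 1 + i = l + i + 1 by omega]
      refine this.trans ?_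
      rw [pow_add]
      have h1 : ((1 : ℝ) / 2) ^ i ≤ 1 := pow_le_one₀ (by norm_num) (by norm_num)
      have h2 : (0 : ℝ) ≤ ε / 4 * (1 / 2) ^ l := by positivity
      calc ε / 4 * ((1 / 2) ^ l * (1 / 2) ^ i) = (ε / 4 * (1 / 2) ^ l) * (1 / 2) ^ i := by ring
        _ ≤ _ := mul_le_of_le_one_right h2 h1
    obtain ⟨y, hy⟩ := cauchySeq_tendsto_of_complete hc
    exact ⟨y, (tendsto_add_atTop_iff_nat i).1 hy⟩
  choose y hy using hlim
  refine ⟨y, fun i => ?_, ?_⟩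
  · have h1 : Tendsto (fun l => t i (w (i + 1) l)) atTop (𝓝 (t i (y (i + 1)))) :=
      ((ht i).tendsto _).comp (hy (i + 1))
    refine tendsto_nhds_unique (h1.congr' ?_) (hy i)
    filter_upwards [eventually_ge_atTop (i + 1)] with l hl
    rw [hw (i + 1) l (by omega), hw i l (by omega), ← transition_one t (Nat.le_succ i),
      transition_transition]
  -- The geometric series sums to `ε / 2`, which leaves room for the strict inequality.
  · have h1 := dist_le_of_le_geometric_of_tendsto₀ (1 / 2) (ε / 4) (by norm_num)
      (fun l => hdist k l (by omega)) (hy k)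
    have h2 : w k 0 = x₀ := by
      rw [hw k 0 le_rfl]
      exact transition_refl t _ _
    rw [h2, dist_comm] at h1
    have : ε / 4 / (1 - 1 / 2) = ε / 2 := by ring
    linarith

end MittagLeffler

/-! ### Coherent sequences over a Fréchet–Stein structure -/

section Coherent

universe u

variable {E : Type*} [NontriviallyNormedField E]
variable {B : ℕ → Type u} [∀ n, NormedRing (B n)] [∀ n, NormedAlgebra E (B n)]
  [∀ n, CompleteSpace (B n)] [∀ n, IsNoetherianRing (B n)]
  (τ : ∀ n, B (n + 1) →ₐ[E] B n)

include E in
/-- The limit of a projective sequence of finitely generated modules generates every term, if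
every module is generated by the image of the next one. -/
theorem span_compatible_eq_top (hτ : ∀ n, Continuous (τ n)) (hτd : ∀ n, DenseRange (τ n))
    {P : ℕ → Type*} [∀ n, AddCommGroup (P n)] [∀ n, Module (B n) (P n)]
    [∀ n, Module.Finite (B n) (P n)] (t : ∀ n, P (n + 1) →ₛₗ[(τ n : B (n + 1) →+* B n)] P n)
    (ht : ∀ n, Submodule.span (B n) (Set.range (t n)) = ⊤) (k : ℕ) :
    Submodule.span (B k) {x | ∃ y : ∀ n, P n, (∀ n, t n (y (n + 1)) = y n) ∧ y k = x} = ⊤ := by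
  choose r f hf using fun n => Module.Finite.exists_fin' (B n) (P n)
  let N := fun n => LinearMap.ker (f n)
  have hN : ∀ n (S : Submodule (B n) (Fin (r n) → B n)), IsClosed (S : Set (Fin (r n) → B n)) :=
    fun n S => isClosed_submodule_pi E S
  have hN' : ∀ n, IsClosed (N n : Set (Fin (r n) → B n)) := fun n => hN n _
  -- A complete normed model of `P n`: the kernel `N n` is closed by Noetherianity.
  let G := fun n => (Fin (r n) → B n) ⧸ N n
  let e : ∀ n, G n ≃ₗ[B n] P n := fun n => (f n).quotKerEquivOfSurjective (hf n)
  have he : ∀ n x, e n ((N n).mkQ x) = f n x := fun n x => rfl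
  let T : ∀ n, G (n + 1) → G n := fun n x => (e n).symm (t n (e (n + 1) x))
  have hTadd : ∀ n x y, T n (x + y) = T n x + T n y := fun n x y => by simp [T]
  have hTsmul : ∀ n b x, T n (b • x) = τ n b • T n x := fun n b x => by simp [T]
  have hTc : ∀ n, Continuous (T n) := by
    intro n
    rw [← (N (n + 1)).isOpenQuotientMap_mkQ.continuous_comp_iff]
    have h1 : Continuous fun x : Fin (r (n + 1)) → B (n + 1) =>
        ∑ i, τ n (x i) • (e n).symm (t n (f (n + 1) (Pi.single i 1))) :=
      continuous_finsetSum _ fun i _ =>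
        ((hτ n).comp (continuous_apply i)).smul continuous_const
    refine h1.congr fun x => ?_
    simp only [Function.comp_apply, T, he]
    rw [apply_eq_sum_single (f (n + 1)) x, map_sum, map_sum]
    simp
  have hTd : ∀ n, DenseRange (T n) := by
    intro n
    -- The closure of the range is stable under the image of `τ n`, hence by density under `B n`. It
    -- is thus a submodule, and it contains a generating set.
    have hrange : ∀ c, ∀ y ∈ closure (Set.range (T n)), τ n c • y ∈ closure (Set.range (T n)) := by
      intro c y hy
      refine map_mem_closure (continuous_const_smul (τ n c)) hy ?_
      rintro _ ⟨x, rfl⟩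
      exact ⟨c • x, hTsmul n c x⟩
    let S : Submodule (B n) (G n) :=
      { carrier := closure (Set.range (T n))
        zero_mem' := subset_closure ⟨0, by simp [T]⟩
        add_mem' := fun {a b} ha hb => map_mem_closure₂ continuous_add ha hb (by
          rintro _ ⟨x, rfl⟩ _ ⟨y, rfl⟩
          exact ⟨x + y, hTadd n x y⟩)
        smul_mem' := fun b y hy => by
          have hcl : IsClosed {b : B n | b • y ∈ closure (Set.range (T n))} :=
            isClosed_closure.preimage (continuous_id.smul continuous_const)
          exact hcl.closure_subset_iff.2 (by rintro _ ⟨c, rfl⟩; exact hrange c y hy) (hτd n b) }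
    have hle : ⊤ ≤ S.comap (e n).symm.toLinearMap := by
      rw [← ht n, Submodule.span_le]
      rintro _ ⟨x, rfl⟩
      exact subset_closure ⟨(e (n + 1)).symm x, by simp [T]⟩
    intro x
    have := hle (x := e n x) trivial
    rw [Submodule.mem_comap, LinearEquiv.coe_coe, LinearEquiv.symm_apply_apply] at this
    exact this
  refine eq_top_iff.2 fun x _ => ?_
  set S := Submodule.span (B k) {x | ∃ y : ∀ n, P n, (∀ n, t n (y (n + 1)) = y n) ∧ y k = x}
  -- Mittag-Leffler makes this submodule dense; being closed, it is everything.
  have hcl : IsClosed ((S.comap (e k).toLinearMap : Submodule (B k) (G k)) : Set (G k)) := by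
    rw [← (N k).isOpenQuotientMap_mkQ.isQuotientMap.isClosed_preimage]
    exact hN k ((S.comap (e k).toLinearMap).comap (N k).mkQ)
  have hmem : (e k).symm x ∈ closure ((S.comap (e k).toLinearMap : Submodule (B k) (G k)) :
      Set (G k)) := by
    refine Metric.mem_closure_iff.2 fun ε hε => ?_
    obtain ⟨y, hy, hyx⟩ := exists_compatible_dist_lt T hTc hTd k ((e k).symm x) hε
    refine ⟨y k, Submodule.subset_span ⟨fun n => e n (y n), fun n => ?_, rfl⟩, by rwa [dist_comm]⟩
    have := congrArg (e n) (hy n)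
    simpa [T] using this
  rw [hcl.closure_eq] at hmem
  simpa using hmem

/-- Along a right flat homomorphism `R → S`, the relations over `S` between the images of elements
of `N` in the base change of `N` are generated by the relations over `R`. -/
theorem IsRightFlat.mem_span_relations {E S : Type*} [NormedField E] {R : Type u} [Ring R]
    [Algebra E R] [Ring S] [Algebra E S] {f : R →ₐ[E] S} (hf : IsRightFlat f)
    {N : Type u} [AddCommGroup N] [Module E N] [Module R N] [IsScalarTower E R N]
    {P : Type*} [AddCommGroup P] [Module E P] [Module S P] [IsScalarTower E S P]
    {t : N →ₛₗ[(f : R →+* S)] P} (ht : IsBaseChangeMap f t) {r : ℕ} (v : Fin r → N)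
    (b : Fin r → S) (hb : ∑ i, b i • t (v i) = 0) :
    b ∈ Submodule.span S
      {d : Fin r → S | ∃ c : Fin r → R, ∑ i, c i • v i = 0 ∧ d = fun i => f (c i)} := by
  set K := Submodule.span S
    {d : Fin r → S | ∃ c : Fin r → R, ∑ i, c i • v i = 0 ∧ d = fun i => f (c i)} with hK
  let F : (Fin r → R) →ₗ[R] N := Fintype.linearCombination R v
  have hF : ∀ c, F c = ∑ i, c i • v i := fun c => Fintype.linearCombination_apply R v c
  let I := LinearMap.range F
  have hFs : ∀ i, F (Pi.single i 1) = v i := fun i => by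
    rw [hF, Finset.sum_eq_single i (fun j _ hj => by simp [hj]) (by simp)]
    simp
  let z : BaseChange f I := ∑ i, BaseChange.tmul f (b i) (⟨v i, Pi.single i 1, hFs i⟩ : I)
  -- Flatness embeds the base change of `I`, the submodule generated by the `v i`, into that of `N`,
  -- which is `P`; there `z` becomes the given relation.
  have hz : z = 0 := by
    refine hf I N I.subtype I.injective_subtype (ht.1 ?_)
    rw [map_zero, map_zero, map_sum, map_sum, ← hb]
    refine Finset.sum_congr rfl fun i _ => ?_
    rw [BaseChange.map_tmul, BaseChange.lift_tmul]
    rfl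
  let θ₀ : (Fin r → R) →ₛₗ[(f : R →+* S)] (Fin r → S) ⧸ K :=
    { toFun := fun c => K.mkQ fun i => f (c i)
      map_add' := fun c d => by
        rw [← map_add]
        congr 1
        ext i
        simp
      map_smul' := fun a c => by
        rw [← map_smul]
        congr 1
        ext i
        simp }
  have hθ₀ : LinearMap.ker F ≤ LinearMap.ker θ₀ := fun c hc => by
    have hc' : ∑ i, c i • v i = 0 := by rw [← hF]; exact hc
    exact (Submodule.Quotient.mk_eq_zero K).2 (Submodule.subset_span ⟨c, hc', rfl⟩)
  -- `θ` sends `v i` to the class of the `i`-th basis vector, so its extension to the base change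
  -- sends `z` to the class of `b`. It is well defined because relations over `R` land in `K`.
  let θ : I →ₛₗ[(f : R →+* S)] (Fin r → S) ⧸ K :=
    ((LinearMap.ker F).liftQ θ₀ hθ₀).comp F.quotKerEquivRange.symm.toLinearMap
  have hθ : ∀ i, θ ⟨v i, Pi.single i 1, hFs i⟩ = K.mkQ (Pi.single i 1) := fun i => by
    have h1 : F.quotKerEquivRange.symm ⟨v i, Pi.single i 1, hFs i⟩ =
        Submodule.Quotient.mk (Pi.single i 1) := by
      rw [LinearEquiv.symm_apply_eq]
      exact Subtype.ext (hFs i).symm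
    change (LinearMap.ker F).liftQ θ₀ hθ₀ (F.quotKerEquivRange.symm _) = _
    rw [h1, Submodule.liftQ_apply]
    change K.mkQ _ = _
    congr 1
    ext j
    by_cases hj : j = i
    · subst hj; simp
    · simp [hj]
  have h0 : K.mkQ b = BaseChange.lift f θ z := by
    rw [map_sum, apply_eq_sum_single K.mkQ b]
    refine Finset.sum_congr rfl fun i _ => ?_
    rw [BaseChange.lift_tmul, hθ]
  rw [hz, map_zero] at h0
  exact (Submodule.Quotient.mk_eq_zero K).1 h0

/-- The module of linear relations between the elements `v i`. -/
def relations (R : Type*) [Ring R] {N : Type*} [AddCommGroup N] [Module R N] {r : ℕ}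
    (v : Fin r → N) : Submodule R (Fin r → R) :=
  LinearMap.ker (Fintype.linearCombination R v)

theorem mem_relations {R : Type*} [Ring R] {N : Type*} [AddCommGroup N] [Module R N] {r : ℕ}
    {v : Fin r → N} {c : Fin r → R} : c ∈ relations R v ↔ ∑ i, c i • v i = 0 := by
  rw [relations, LinearMap.mem_ker, Fintype.linearCombination_apply]

/-- A semilinear map induces a map between modules of relations. -/
def relationsMap {R S : Type*} [Ring R] [Ring S] (f : R →+* S) {N P : Type*} [AddCommGroup N]
    [Module R N] [AddCommGroup P] [Module S P] (t : N →ₛₗ[f] P) {r : ℕ} (v : Fin r → N)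
    (w : Fin r → P) (h : ∀ i, t (v i) = w i) : relations R v →ₛₗ[f] relations S w where
  toFun c := ⟨fun i => f (c.1 i), by
    have := congrArg t (mem_relations.1 c.2)
    rw [mem_relations, ← t.map_zero, ← this, map_sum]
    refine Finset.sum_congr rfl fun i _ => ?_
    rw [map_smulₛₗ, h]⟩
  map_add' c d := by ext i; simp
  map_smul' a c := by ext i; simp

/-- This is `mem_span_relations` read inside the module of relations, the form in which
`span_compatible_eq_top` applies to the sequence of relation modules. -/
theorem IsRightFlat.span_range_relationsMap {E S : Type*} [NormedField E] {R : Type u} [Ring R]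
    [Algebra E R] [Ring S] [Algebra E S] {f : R →ₐ[E] S} (hf : IsRightFlat f)
    {N : Type u} [AddCommGroup N] [Module E N] [Module R N] [IsScalarTower E R N]
    {P : Type*} [AddCommGroup P] [Module E P] [Module S P] [IsScalarTower E S P]
    {t : N →ₛₗ[(f : R →+* S)] P} (ht : IsBaseChangeMap f t) {r : ℕ} (v : Fin r → N)
    (w : Fin r → P) (h : ∀ i, t (v i) = w i) :
    Submodule.span S (Set.range (relationsMap (f : R →+* S) t v w h)) = ⊤ := by
  have h1 : ∀ c ∈ relations S w, c ∈ (Submodule.span S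
      (Set.range (relationsMap (f : R →+* S) t v w h))).map (relations S w).subtype := by
    intro c hc
    have h2 := hf.mem_span_relations ht v c (by simpa only [h] using mem_relations.1 hc)
    refine Submodule.span_le.2 ?_ h2
    rintro _ ⟨d, hd, rfl⟩
    exact ⟨relationsMap (f : R →+* S) t v w h ⟨d, mem_relations.2 hd⟩,
      Submodule.subset_span ⟨_, rfl⟩, rfl⟩
  refine eq_top_iff.2 fun c _ => ?_
  obtain ⟨c', hc', hcc'⟩ := h1 c c.2
  rwa [Subtype.ext hcc'] at hc'

/-- Relations over `S` that are generated by relations over `A` vanish in the base change. -/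
theorem sum_tmul_eq_zero_of_mem_span {E A S : Type*} [NormedField E] [Ring A] [Algebra E A] [Ring S]
    [Algebra E S] (f : A →ₐ[E] S) {M : Type*} [AddCommGroup M] [Module E M] [Module A M]
    {r : ℕ} (m : Fin r → M) {b : Fin r → S} (hb : b ∈ Submodule.span S
      {d : Fin r → S | ∃ α : Fin r → A, ∑ i, α i • m i = 0 ∧ d = fun i => f (α i)}) :
    ∑ i, BaseChange.tmul f (b i) (m i) = 0 := by
  let Ψ : (Fin r → S) →ₗ[S] BaseChange f M :=
    Fintype.linearCombination S fun i => BaseChange.tmul f 1 (m i)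
  have hΨ : ∀ c, Ψ c = ∑ i, BaseChange.tmul f (c i) (m i) := fun c => by
    rw [Fintype.linearCombination_apply]
    exact Finset.sum_congr rfl fun i _ => BaseChange.smul_one_tmul _ _ _
  rw [← hΨ]
  refine LinearMap.mem_ker.1 (Submodule.span_le.2 ?_ hb)
  rintro _ ⟨α, hα, rfl⟩
  have h1 : Ψ (fun i => f (α i)) = BaseChange.unit f M (∑ i, α i • m i) := by
    rw [hΨ, map_sum]
    refine Finset.sum_congr rfl fun i _ => ?_
    rw [map_smulₛₗ]
    exact (BaseChange.smul_one_tmul _ _ _).symm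
  rw [SetLike.mem_coe, LinearMap.mem_ker, h1, hα, map_zero]

/-- For a coherent sequence `N n` over a Fréchet–Stein structure on `A`, with limit `M`, every
`N n` is the base change of `M`. -/
theorem isBaseChangeMap_of_coherent (hτ : ∀ n, Continuous (τ n)) (hτd : ∀ n, DenseRange (τ n))
    (hflat : ∀ n, IsRightFlat (τ n)) {A : Type*} [Ring A] [Algebra E A] (pr : ∀ n, A →ₐ[E] B n)
    (hpr : ∀ b : ∀ n, B n, (∀ n, τ n (b (n + 1)) = b n) → ∃ a, ∀ n, pr n a = b n)
    {N : ℕ → Type u} [∀ n, AddCommGroup (N n)] [∀ n, Module E (N n)] [∀ n, Module (B n) (N n)]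
    [∀ n, IsScalarTower E (B n) (N n)] [∀ n, Module.Finite (B n) (N n)]
    (t : ∀ n, N (n + 1) →ₛₗ[(τ n : B (n + 1) →+* B n)] N n)
    (ht : ∀ n, IsBaseChangeMap (τ n) (t n)) {M : Type*} [AddCommGroup M] [Module E M]
    [Module A M] [IsScalarTower E A M] (π : ∀ n, M →ₛₗ[(pr n : A →+* B n)] N n)
    (hπt : ∀ n x, t n (π (n + 1) x) = π n x) (hπinj : ∀ x, (∀ n, π n x = 0) → x = 0)
    (hπsurj : ∀ y : ∀ n, N n, (∀ n, t n (y (n + 1)) = y n) → ∃ x, ∀ n, π n x = y n) (k : ℕ) :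
    IsBaseChangeMap (pr k) (π k) := by
  have hspan : Submodule.span (B k) (Set.range (π k)) = ⊤ := by
    rw [eq_top_iff, ← span_compatible_eq_top τ hτ hτd t (fun n => (ht n).span_range) k]
    refine Submodule.span_mono ?_
    rintro _ ⟨y, hy, rfl⟩
    obtain ⟨x, hx⟩ := hπsurj y hy
    exact ⟨x, hx k⟩
  refine ⟨(injective_iff_map_eq_zero _).2 fun z hz => ?_, ?_⟩
  · obtain ⟨r, b, m, rfl⟩ := BaseChange.exists_sum (pr k) z
    let ℓ : ∀ n, relations (B (n + 1)) (fun i => π (n + 1) (m i)) →ₛₗ[(τ n : B (n + 1) →+* B n)]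
        relations (B n) (fun i => π n (m i)) := fun n => relationsMap (τ n : B (n + 1) →+* B n) (t n)
      (fun i => π (n + 1) (m i)) (fun i => π n (m i)) fun i => hπt n (m i)
    have hb : b ∈ relations (B k) fun i => π k (m i) := by
      rw [mem_relations, ← hz, map_sum]
      simp only [BaseChange.lift_tmul]
    -- Relation modules are finitely generated by Noetherianity, so `b` is a combination of
    -- compatible families of relations.
    have hgen := span_compatible_eq_top (P := fun n => relations (B n) fun i => π n (m i)) τ hτ hτd ℓ
      (fun n => (hflat n).span_range_relationsMap (ht n) _ _ _) k
    have hbspan := Submodule.mem_map_of_mem (f := (relations (B k) fun i => π k (m i)).subtype)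
      (hgen ▸ Submodule.mem_top : (⟨b, hb⟩ : relations (B k) fun i => π k (m i)) ∈ _)
    rw [Submodule.map_span] at hbspan
    refine sum_tmul_eq_zero_of_mem_span (pr k) m (Submodule.span_mono ?_ hbspan)
    rintro _ ⟨_, ⟨y, hy, rfl⟩, rfl⟩
    -- Each coordinate of a compatible family of relations comes from `A`. The result is a relation
    -- over `A` because the `π n` are jointly injective.
    choose α hα using fun i => hpr (fun n => (y n).1 i) fun n =>
      congrFun (congrArg Subtype.val (hy n)) i
    refine ⟨α, hπinj _ fun n => ?_, funext fun i => (hα i k).symm⟩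
    rw [map_sum, ← mem_relations.1 (y n).2]
    refine Finset.sum_congr rfl fun i _ => ?_
    rw [map_smulₛₗ, ← hα i n]
    rfl
  · rw [← LinearMap.range_eq_top, eq_top_iff, ← hspan, Submodule.span_le]
    rintro _ ⟨x, rfl⟩
    exact ⟨BaseChange.tmul (pr k) 1 x, by rw [BaseChange.lift_tmul, one_smul]⟩

end Coherent

/-! ### Comparison of two structures on the same algebra -/

section Extension

/-- A homomorphism into a Banach algebra that is bounded on the preimage of a neighbourhood of zero
along a homomorphism with dense image extends along this homomorphism. -/
theorem exists_algHom_extension {E A C B : Type*} [NontriviallyNormedField E] [Ring A] [Algebra E A]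
    [Ring C] [Algebra E C] [TopologicalSpace C] [IsTopologicalRing C] [ContinuousSMul E C]
    [NormedRing B] [NormedAlgebra E B] [CompleteSpace B] (p : A →ₐ[E] C) (hp : DenseRange p)
    (q : A →ₐ[E] B) {V : Set C} (hV : V ∈ 𝓝 0) (hq : ∀ a, p a ∈ V → ‖q a‖ ≤ 1) :
    ∃ s : C →ₐ[E] B, Continuous s ∧ ∀ a, s (p a) = q a := by
  let : UniformSpace C := IsTopologicalAddGroup.rightUniformSpace C
  have : IsUniformAddGroup C := isUniformAddGroup_of_addCommGroup
  -- `A` gets the uniformity induced by `p`; then `q` is uniformly continuous and extends along the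
  -- dense map `p` to the complete algebra `B`.
  let : UniformSpace A := UniformSpace.comap p inferInstance
  have : IsUniformAddGroup A := IsUniformAddGroup.comap p
  have hpi : IsUniformInducing (p : A →+* C) := ⟨rfl⟩
  have hqc : UniformContinuous (q : A →+* B) := by
    refine uniformContinuous_of_continuousAt_zero (q : A →+* B) ?_
    rw [ContinuousAt, map_zero, Metric.tendsto_nhds]
    intro ε hε
    obtain ⟨c, hc0, hcε⟩ := NormedField.exists_norm_lt E hε
    have hc : c ≠ 0 := norm_pos_iff.1 hc0
    have h1 : (fun x : C => c⁻¹ • x) ⁻¹' V ∈ 𝓝 (0 : C) :=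
      (continuous_const_smul c⁻¹).continuousAt.preimage_mem_nhds (by simpa using hV)
    have h2 : p ⁻¹' ((fun x : C => c⁻¹ • x) ⁻¹' V) ∈ 𝓝 (0 : A) :=
      hpi.uniformContinuous.continuous.continuousAt.preimage_mem_nhds (by simpa using h1)
    filter_upwards [h2] with a ha
    have h3 := hq (c⁻¹ • a) (by simpa using ha)
    rw [map_smul, norm_smul, norm_inv, inv_mul_le_iff₀ hc0, mul_one] at h3
    rw [dist_zero_right]
    exact h3.trans_lt hcε
  let s₀ : C →+* B := IsDenseInducing.extendRingHom hpi hp hqc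
  have hs₀ : ∀ a, s₀ (p a) = q a := fun a =>
    IsDenseInducing.extend_eq (hpi.isDenseInducing hp) hqc.continuous a
  refine ⟨{ s₀ with commutes' := fun c => ?_ }, ?_, hs₀⟩
  · have := hs₀ (algebraMap E A c)
    rw [AlgHom.commutes, AlgHom.commutes] at this
    exact this
  · exact (uniformContinuous_uniformly_extend hpi hp hqc).continuous

/-- The preimage of the unit ball under `q` contains a neighbourhood of zero that involves only
finitely many `X n`. Such a condition can be imposed in a single `X m` with `m` large, so
`exists_algHom_extension` applies. -/
theorem exists_algHom_of_isProjectiveLimit {E A B : Type*} [NontriviallyNormedField E] [Ring A]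
    [Algebra E A] [TopologicalSpace A] {X : ℕ → Type*} [∀ n, Ring (X n)] [∀ n, Algebra E (X n)]
    [∀ n, TopologicalSpace (X n)] [∀ n, IsTopologicalRing (X n)] [∀ n, ContinuousSMul E (X n)]
    (τ : ∀ n, X (n + 1) →ₐ[E] X n) (hτ : ∀ n, Continuous (τ n)) (pr : ∀ n, A →ₐ[E] X n)
    (hpr : IsProjectiveLimit (fun n => τ n) fun n => pr n) (hd : ∀ n, DenseRange (pr n))
    [NormedRing B] [NormedAlgebra E B] [CompleteSpace B] (q : A →ₐ[E] B) (hq : Continuous q) :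
    ∃ m₀, ∀ m, m₀ ≤ m → ∃ s : X m →ₐ[E] B, Continuous s ∧ ∀ a, s (pr m a) = q a := by
  have hcompat : ∀ n a, τ n (pr (n + 1) a) = pr n a := fun n a => by
    have : (fun n => pr n a) ∈ {x : ∀ n, X n | ∀ n, τ n (x (n + 1)) = x n} := hpr.2 ▸ ⟨a, rfl⟩
    exact this n
  have h1 : q ⁻¹' Metric.closedBall 0 1 ∈ 𝓝 (0 : A) :=
    hq.continuousAt.preimage_mem_nhds (by simpa using Metric.closedBall_mem_nhds (0 : B) one_pos)
  rw [hpr.1.isInducing.nhds_eq_comap, Filter.mem_comap] at h1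
  obtain ⟨U, hU, hUq⟩ := h1
  rw [nhds_pi, Filter.mem_pi] at hU
  obtain ⟨I, hI, W, hW, hWU⟩ := hU
  obtain ⟨m₀, hm₀⟩ := hI.bddAbove
  refine ⟨m₀, fun m hm => ?_⟩
  have hV : {c : X m | ∀ i ∈ I, ∀ h : i ≤ m, transition (fun n => τ n) h c ∈ W i} ∈ 𝓝 0 := by
    refine (Filter.eventually_all_finite hI).2 fun i hi => ?_
    have hc := continuous_transition (fun n => τ n) hτ ((hm₀ hi).trans hm)
    have h0 : transition (fun n => τ n) ((hm₀ hi).trans hm) 0 = 0 := by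
      rw [← algTransition_apply, map_zero]
    have := hc.continuousAt (x := 0).preimage_mem_nhds (t := W i) (by
      rw [h0]; simpa using hW i)
    filter_upwards [this] with c hc _
    exact hc
  refine exists_algHom_extension (pr m) (hd m) q hV fun a ha => ?_
  have : a ∈ q ⁻¹' Metric.closedBall 0 1 := hUq (hWU fun i hi => by
    have h2 := ha i hi ((hm₀ hi).trans hm)
    rwa [transition_apply_of_compatible (fun n => τ n) _ (x := fun n => pr n a)
      fun n => hcompat n a] at h2)
  simpa using this

end Extension

/-! ### Interleaving the two projective systems -/

section Ladder

/-- The composition of semilinear maps over a composition of homomorphisms of algebras. -/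
def semilinearComp {E R S T : Type*} [NormedField E] [Ring R] [Algebra E R] [Ring S] [Algebra E S]
    [Ring T] [Algebra E T] {M N P : Type*} [AddCommGroup M] [Module R M] [AddCommGroup N]
    [Module S N] [AddCommGroup P] [Module T P] {f : R →ₐ[E] S} {g : S →ₐ[E] T} (h : R →ₐ[E] T)
    (hgf : ∀ r, h r = g (f r)) (ψ : N →ₛₗ[(g : S →+* T)] P) (φ : M →ₛₗ[(f : R →+* S)] N) :
    M →ₛₗ[(h : R →+* T)] P where
  toFun x := ψ (φ x)
  map_add' := by simp
  map_smul' r x := by simp [hgf]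

/-- The base change of a finitely generated module, as a quotient of a finite free module. -/
theorem exists_isBaseChangeMap_quotient {E R S : Type*} [NormedField E] [Ring R] [Algebra E R]
    [Ring S] [Algebra E S] (f : R →ₐ[E] S) (M : Type*) [AddCommGroup M] [Module E M] [Module R M]
    [IsScalarTower E R M] [Module.Finite R M] :
    ∃ (r : ℕ) (K : Submodule S (Fin r → S)) (σ : M →ₛₗ[(f : R →+* S)] (Fin r → S) ⧸ K),
      IsBaseChangeMap f σ := by
  obtain ⟨r, g, hg⟩ := Module.Finite.exists_fin' R M
  let F : (Fin r → S) →ₗ[S] BaseChange f M :=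
    Fintype.linearCombination S fun i => BaseChange.tmul f 1 (g (Pi.single i 1))
  have hF : Function.Surjective F := by
    rw [← LinearMap.range_eq_top, eq_top_iff, ← (isBaseChangeMap_unit f).span_range,
      Submodule.span_le]
    rintro _ ⟨m, rfl⟩
    obtain ⟨x, rfl⟩ := hg m
    refine ⟨fun i => f (x i), ?_⟩
    rw [apply_eq_sum_single g x, map_sum, Fintype.linearCombination_apply]
    refine Finset.sum_congr rfl fun i _ => ?_
    rw [map_smulₛₗ]
    rfl
  let e := F.quotKerEquivOfSurjective hF
  refine ⟨r, LinearMap.ker F, e.symm.toLinearMap.comp (BaseChange.unit f M), ?_⟩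
  exact (isBaseChangeMap_unit f).of_equiv e.symm fun m => rfl

universe u

variable {E : Type*} [NontriviallyNormedField E] {A : Type*} [Ring A] [Algebra E A]
  {X : ℕ → Type*} [∀ n, Ring (X n)] [∀ n, Algebra E (X n)]
  (τA : ∀ n, X (n + 1) →ₐ[E] X n) (prA : ∀ n, A →ₐ[E] X n)
  {B : ℕ → Type u} [∀ n, NormedRing (B n)] [∀ n, NormedAlgebra E (B n)]
  [∀ n, CompleteSpace (B n)] [∀ n, IsNoetherianRing (B n)]
  (τB : ∀ n, B (n + 1) →ₐ[E] B n) (prB : ∀ n, A →ₐ[E] B n)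

/-- If the sequence `X n` and a Fréchet–Stein structure `B n` on `A` are cofinal in each other, then
a coherent sequence `N n` over the `X n` consists of the base changes of its limit. The `L k` are
the base changes of the `N (m k)` to `B k`. -/
theorem isBaseChangeMap_of_ladder (hτB : ∀ n, Continuous (τB n)) (hτBd : ∀ n, DenseRange (τB n))
    (hflat : ∀ n, IsRightFlat (τB n))
    (hprB : ∀ b : ∀ n, B n, (∀ n, τB n (b (n + 1)) = b n) → ∃ a, ∀ n, prB n a = b n)
    (i : ∀ n, B n →ₐ[E] X n) (hiprB : ∀ n a, i n (prB n a) = prA n a)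
    (hiτ : ∀ n b, i n (τB n b) = τA n (i (n + 1) b))
    (m : ℕ → ℕ) (hm : ∀ k, k ≤ m k) (hmm : ∀ k, m k ≤ m (k + 1))
    (s : ∀ k, X (m k) →ₐ[E] B k)
    (his : ∀ k c, i k (s k c) = algTransition τA (hm k) c)
    (hsτ : ∀ k c, τB k (s (k + 1) c) = s k (algTransition τA (hmm k) c))
    (hsi : ∀ k b, s k (i (m k) b) = algTransition τB (hm k) b)
    (hspr : ∀ k a, s k (prA (m k) a) = prB k a)
    {M : Type*} [AddCommGroup M] [Module E M] [Module A M] [IsScalarTower E A M]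
    {N : ℕ → Type*} [∀ n, AddCommGroup (N n)] [∀ n, Module E (N n)] [∀ n, Module (X n) (N n)]
    [∀ n, IsScalarTower E (X n) (N n)] [∀ n, Module.Finite (X n) (N n)]
    (t : ∀ n, N (n + 1) →ₛₗ[(τA n : X (n + 1) →+* X n)] N n)
    (ht : ∀ n, IsBaseChangeMap (τA n) (t n)) (prM : ∀ n, M →ₛₗ[(prA n : A →+* X n)] N n)
    (hprMt : ∀ n x, t n (prM (n + 1) x) = prM n x) (hprMinj : ∀ x, (∀ n, prM n x = 0) → x = 0)
    (hprMsurj : ∀ y : ∀ n, N n, (∀ n, t n (y (n + 1)) = y n) → ∃ x, ∀ n, prM n x = y n)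
    {L : ℕ → Type u} [∀ k, AddCommGroup (L k)] [∀ k, Module E (L k)] [∀ k, Module (B k) (L k)]
    [∀ k, IsScalarTower E (B k) (L k)] [∀ k, Module.Finite (B k) (L k)]
    (σ : ∀ k, N (m k) →ₛₗ[(s k : X (m k) →+* B k)] L k) (hσ : ∀ k, IsBaseChangeMap (s k) (σ k))
    (n : ℕ) : IsBaseChangeMap (prA n) (prM n) := by
  choose T hT hTb using fun (n m : ℕ) (h : n ≤ m) => exists_isBaseChangeMap_transition τA t ht h
  -- the transition maps of the `L k`
  let sτ : ∀ k, X (m (k + 1)) →ₐ[E] B k := fun k => (s k).comp (algTransition τA (hmm k))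
  let χ : ∀ k, N (m (k + 1)) →ₛₗ[(sτ k : X (m (k + 1)) →+* B k)] L k := fun k =>
    semilinearComp (sτ k) (fun _ => rfl) (σ k) (T _ _ (hmm k))
  have hχ : ∀ k, IsBaseChangeMap (sτ k) (χ k) := fun k =>
    ((hTb _ _ (hmm k)).comp_iff (fun _ => rfl) fun _ => rfl).2 (hσ k)
  choose ℓ hℓ using fun k => (hσ (k + 1)).exists_extension (τB k) (sτ k)
    (fun c => (hsτ k c).symm) (χ k)
  -- The map `X (m (k + 1)) → B k` also factors through `B (k + 1)`, by `hsτ`, and the first base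
  -- change can be cancelled.
  have hℓb : ∀ k, IsBaseChangeMap (τB k) (ℓ k) := fun k =>
    ((hσ (k + 1)).comp_iff (fun c => (hsτ k c).symm) fun x => (hℓ k x).symm).1 (hχ k)
  -- the maps `L k → N k`
  choose ρ hρ using fun k => (hσ k).exists_extension (i k) (algTransition τA (hm k))
    (fun c => (his k c).symm) (T _ _ (hm k))
  have hρb : ∀ k, IsBaseChangeMap (i k) (ρ k) := fun k =>
    ((hσ k).comp_iff (fun c => (his k c).symm) fun x => (hρ k x).symm).1 (hTb _ _ (hm k))
  have hρℓ : ∀ k x, t k (ρ (k + 1) x) = ρ k (ℓ k x) := by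
    intro k
    refine (hσ (k + 1)).ext (g := ((τA k).comp (i (k + 1)) : B (k + 1) →+* X k))
      (by simp) (by simp) (fun b x => ?_) (fun b x => ?_) fun x => ?_
    · rw [map_smulₛₗ, map_smulₛₗ]; rfl
    · rw [map_smulₛₗ, map_smulₛₗ]
      congr 1
      exact hiτ k b
    · rw [hρ, hℓ]
      change t k (T _ _ (hm (k + 1)) x) = ρ k (σ k (T _ _ (hmm k) x))
      rw [hρ, hT, hT, hT, ← transition_one (fun n => t n) (Nat.le_succ k), transition_transition,
        transition_transition]
  have hℓσ : ∀ k j (h : k ≤ j) (hmkj : m k ≤ m j) x,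
      transition (fun n => ℓ n) h (σ j x) = σ k (transition (fun n => t n) hmkj x) := by
    intro k j h
    induction j, h using Nat.le_induction with
    | base => intro _ x; rw [transition_refl, transition_refl]
    | succ j hj ih =>
      intro hmkj x
      have hmkj' : m k ≤ m j := monotone_nat_of_le_succ hmm hj
      rw [transition_succ _ hj, hℓ]
      change transition (fun n => ℓ n) hj (σ j (T _ _ (hmm j) x)) = _
      rw [ih hmkj', hT, transition_transition]
  -- With `hρ`, both composites `N (m k) → L k → N k` and `L (m k) → N (m k) → L k` are transition
  -- maps, so the two sequences have the same limit.
  have hσρ : ∀ k x, σ k (ρ (m k) x) = transition (fun n => ℓ n) (hm k) x := by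
    intro k
    obtain ⟨φ, hφ, -⟩ := exists_isBaseChangeMap_transition τB ℓ hℓb (hm k)
    refine (hσ (m k)).ext (g := (algTransition τB (hm k) : B (m k) →+* B k)) (by simp)
      (fun x y => by rw [← hφ, ← hφ, ← hφ, map_add]) (fun b x => ?_)
      (fun b x => by rw [← hφ, ← hφ, map_smulₛₗ]) fun x => ?_
    · rw [map_smulₛₗ, map_smulₛₗ]
      congr 1
      exact hsi k b
    · rw [hρ, hℓσ k (m k) (hm k) (hm (m k)), hT]
  -- the maps `M → L k`
  let π : ∀ k, M →ₛₗ[(prB k : A →+* B k)] L k := fun k =>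
    semilinearComp (prB k) (fun a => (hspr k a).symm) (σ k) (prM (m k))
  have hprMT : ∀ {k j : ℕ} (h : k ≤ j) x, transition (fun n => t n) h (prM j x) = prM k x :=
    fun h x => transition_apply_of_compatible (fun n => t n) h (x := fun n => prM n x)
      fun n => hprMt n x
  have hρπ : ∀ k x, ρ k (π k x) = prM k x := fun k x => by
    change ρ k (σ k (prM (m k) x)) = _
    rw [hρ, hT, hprMT]
  have hπ : IsBaseChangeMap (prB n) (π n) := by
    refine isBaseChangeMap_of_coherent τB hτB hτBd hflat prB hprB ℓ hℓb π (fun k x => ?_)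
      (fun x hx => hprMinj x fun k => by rw [← hρπ, hx, map_zero]) (fun y hy => ?_) n
    · change ℓ k (σ (k + 1) (prM (m (k + 1)) x)) = σ k (prM (m k) x)
      rw [hℓ]
      change σ k (T _ _ (hmm k) (prM (m (k + 1)) x)) = _
      rw [hT, hprMT]
    -- A compatible family in the `L k` is pushed to the `N k` and lifted to `M`; `hσρ` recovers `y
    -- k` from `y (m k)`.
    · obtain ⟨x, hx⟩ := hprMsurj (fun k => ρ k (y k)) fun k => by rw [hρℓ, hy]
      refine ⟨x, fun k => ?_⟩
      change σ k (prM (m k) x) = y k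
      rw [hx, hσρ]
      exact transition_apply_of_compatible (fun n => ℓ n) (hm k) hy
  -- Transitivity along `A → B n → X n`, with `M → L n → N n`.
  exact (hπ.comp_iff (fun a => (hiprB n a).symm) fun x => (hρπ n x).symm).2 (hρb n)

end Ladder

/-! ### Consequences of the definitions, and the theorem itself -/

theorem IsBH.continuous {E U : Type*} {V : Type*} [NormedField E] [AddCommGroup U] [Module E U]
    [TopologicalSpace U] [AddCommGroup V] [Module E V] [TopologicalSpace V]
    {f : U →ₗ[E] V} (hf : IsBH f) : Continuous f := by
  obtain ⟨T, _, _, _, _, g, h, hgh⟩ := hf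
  exact (h.continuous.comp g.continuous).congr fun u => (hgh u).symm

theorem IsProjectiveLimit.apply_succ {X : ℕ → Type*} [∀ n, TopologicalSpace (X n)]
    {τ : ∀ n, X (n + 1) → X n} {Y : Type*} [TopologicalSpace Y] {π : ∀ n, Y → X n}
    (h : IsProjectiveLimit τ π) (n : ℕ) (y : Y) : τ n (π (n + 1) y) = π n y := by
  have : (fun n => π n y) ∈ {x : ∀ n, X n | ∀ n, τ n (x (n + 1)) = x n} := h.2 ▸ ⟨y, rfl⟩
  exact this n

theorem IsProjectiveLimit.exists_apply_eq {X : ℕ → Type*} [∀ n, TopologicalSpace (X n)]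
    {τ : ∀ n, X (n + 1) → X n} {Y : Type*} [TopologicalSpace Y] {π : ∀ n, Y → X n}
    (h : IsProjectiveLimit τ π) (x : ∀ n, X n) (hx : ∀ n, τ n (x (n + 1)) = x n) :
    ∃ y, ∀ n, π n y = x n := by
  have : x ∈ Set.range fun y n => π n y := h.2 ▸ hx
  obtain ⟨y, rfl⟩ := this
  exact ⟨y, fun n => rfl⟩

theorem IsProjectiveLimit.continuous {X : ℕ → Type*} [∀ n, TopologicalSpace (X n)]
    {τ : ∀ n, X (n + 1) → X n} {Y : Type*} [TopologicalSpace Y] {π : ∀ n, Y → X n}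
    (h : IsProjectiveLimit τ π) (n : ℕ) : Continuous (π n) :=
  (continuous_apply n).comp h.1.continuous

end FrechetStein

theorem theorem2p9
    -- `E` is a finite extension of `ℚ_p` with the extended absolute value
    {p : ℕ} [Fact p.Prime] {E : Type*} [NontriviallyNormedField E] [NormedAlgebra ℚ_[p] E]
    [FiniteDimensional ℚ_[p] E]
    -- `A` is a locally convex topological `E`-algebra
    {A : Type*} [Ring A] [Algebra E A] [TopologicalSpace A] [IsTopologicalRing A]
    [ContinuousSMul E A] [FrechetStein.LocallyConvex E A]
    -- the weak Fréchet–Stein structure `A ≅ lim An`, with `An` of compact type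
    {An : ℕ → Type*} [∀ n, Ring (An n)] [∀ n, Algebra E (An n)] [∀ n, TopologicalSpace (An n)]
    [∀ n, IsTopologicalRing (An n)]
    (τA : ∀ n, An (n + 1) →ₐ[E] An n) (prA : ∀ n, A →ₐ[E] An n)
    (hA : FrechetStein.IsWeakFrechetStein τA prA)
    (hAn : ∀ n, FrechetStein.IsCompactTypeAlgebra E (An n))
    -- the projective system of left Noetherian Banach algebras `B n`
    {B : ℕ → Type*} [∀ n, NormedRing (B n)] [∀ n, NormedAlgebra E (B n)]
    [∀ n, IsUltrametricDist (B n)] [∀ n, CompleteSpace (B n)] [∀ n, IsNoetherianRing (B n)]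
    (τB : ∀ n, B (n + 1) →ₐ[E] B n)
    -- the morphism of projective systems `B n → An n`
    (i : ∀ n, B n →ₐ[E] An n) (hi : ∀ n, Continuous (i n))
    (hiτ : ∀ n b, i n (τB n b) = τA n (i (n + 1) b))
    -- the limit of the `i n` is an isomorphism, with inverse `prB`, and gives a
    -- Fréchet–Stein structure `A ≅ lim B n`
    (prB : ∀ n, A →ₐ[E] B n) (hprB : ∀ n a, i n (prB n a) = prA n a)
    (hB : FrechetStein.IsFrechetStein τB prB)
    -- `M` is a locally convex topological `A`-module
    {M : Type*} [AddCommGroup M] [Module E M] [Module A M] [IsScalarTower E A M]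
    [TopologicalSpace M] [IsTopologicalAddGroup M] [ContinuousSMul A M]
    [FrechetStein.LocallyConvex E M]
    -- the `Mn n` are topological `An n`-modules
    {Mn : ℕ → Type*} [∀ n, AddCommGroup (Mn n)] [∀ n, Module E (Mn n)]
    [∀ n, Module (An n) (Mn n)] [∀ n, IsScalarTower E (An n) (Mn n)]
    [∀ n, TopologicalSpace (Mn n)] [∀ n, ContinuousSMul (An n) (Mn n)]
    -- they carry the canonical topology, i.e. the compact type topology with continuous action
    (hMn : ∀ n, FrechetStein.IsCompactTypeSpace E (Mn n))
    -- and form an `{An n}`-sequence for the coadmissible module `M ≅ lim Mn`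
    (prM : ∀ n, M →ₛₗ[(prA n : A →+* An n)] Mn n)
    (hM : FrechetStein.IsCoadmissibleSequence τA prA prM) (n : ℕ) :
    Function.Bijective (FrechetStein.BaseChange.lift (prA n) (prM n)) := by

  have := hA.continuousSMul
  have hlc : ∀ n, (inferInstance : TopologicalSpace (An n)) ∈ locallyConvexTopologies E (An n) :=
    fun n => ⟨inferInstance, hA.continuousSMul n, hA.locallyConvex n⟩
  have hT2 : ∀ n, T2Space (An n) := fun n => (hA.hereditarilyComplete n).1
  have hτA : ∀ n, Continuous (τA n) := fun n => (hA.isBH n).continuous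
  have hτB : ∀ n, Continuous (τB n) := fun n => (hB.isBH n).continuous
  have hprBτ : ∀ n a, τB n (prB (n + 1) a) = prB n a := hB.isProjectiveLimit.apply_succ
  have hprAτ : ∀ n a, τA n (prA (n + 1) a) = prA n a := hA.isProjectiveLimit.apply_succ
  have hTA : ∀ {k m : ℕ} (h : k ≤ m) (a : A), algTransition τA h (prA m a) = prA k a :=
    fun h a => by
      rw [algTransition_apply]
      exact transition_apply_of_compatible (fun n => τA n) h (x := fun n => prA n a)
        fun n => hprAτ n a
  have hTB : ∀ {k m : ℕ} (h : k ≤ m) (a : A), algTransition τB h (prB m a) = prB k a :=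
    fun h a => by
      rw [algTransition_apply]
      exact transition_apply_of_compatible (fun n => τB n) h (x := fun n => prB n a)
        fun n => hprBτ n a
  have hTAc : ∀ {k m : ℕ} (h : k ≤ m), Continuous (algTransition τA h) := fun h =>
    (continuous_transition (fun n => τA n) hτA h).congr fun x => (algTransition_apply τA h x).symm
  have hTBc : ∀ {k m : ℕ} (h : k ≤ m), Continuous (algTransition τB h) := fun h =>
    (continuous_transition (fun n => τB n) hτB h).congr fun x => (algTransition_apply τB h x).symm
  choose m₀ hm₀ using fun k => exists_algHom_of_isProjectiveLimit τA hτA prA hA.isProjectiveLimit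
    hA.denseRange (prB k) (hB.isProjectiveLimit.continuous k)
  -- Chosen to be monotone, with `m k ≥ k` and `m k ≥ m₀ k`.
  let m : ℕ → ℕ := fun k => k + ∑ l ∈ Finset.range (k + 1), m₀ l
  choose s hsc hspr using fun k => hm₀ k (m k)
    ((Finset.single_le_sum (fun _ _ => Nat.zero_le _)
      (Finset.mem_range.2 (Nat.lt_succ_self k))).trans (Nat.le_add_left _ _))
  have hmm : ∀ k, m k ≤ m (k + 1) := fun k => by
    simp only [m]
    rw [Finset.sum_range_succ _ (k + 1)]
    omega
  obtain ⟨e, he⟩ := hM.exists_iso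
  -- `Mn n` is homeomorphic to a completion, which is Hausdorff by construction.
  have hMT2 : ∀ n, T2Space (Mn n) := fun n => (e n).toHomeomorph.t2Space
  have := hM.finite
  let t : ∀ n, Mn (n + 1) →ₛₗ[(τA n : An (n + 1) →+* An n)] Mn n := fun n =>
    { toFun := fun x => e n ((BaseChange.tmul (τA n) 1 x : BaseChange (τA n) (Mn (n + 1))) :
        CompletedBaseChange (τA n) (Mn (n + 1)))
      map_add' := fun x y => by
        rw [BaseChange.tmul_add, UniformSpace.Completion.coe_add, map_add]
      map_smul' := fun c x => by
        rw [← BaseChange.mul_tmul, one_mul, ← BaseChange.smul_one_tmul,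
          UniformSpace.Completion.coe_smul, map_smul]
        rfl }
  have ht : ∀ n, IsBaseChangeMap (τA n) (t n) := fun n =>
    isBaseChangeMap_of_completed (hAn (n + 1)) (hlc (n + 1)) (hAn n) (hlc n) (τA n) (hτA n)
      (hMn (n + 1)) (hMn n) (e n) (t n) fun x => rfl
  -- As quotients of finite free modules, the `L k` stay in the universe of the `B k`, as the test
  -- modules in `IsRightFlat` must.
  choose r K σ hσ using fun k => exists_isBaseChangeMap_quotient (s k) (Mn (m k))
  refine isBaseChangeMap_of_ladder τA prA τB prB hτB (fun n => ?_) hB.isRightFlat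
    hB.isProjectiveLimit.exists_apply_eq i hprB hiτ m (fun k => Nat.le_add_right _ _) hmm s
    (fun k => ?_) (fun k => ?_) (fun k => ?_) hspr t ht prM he.apply_succ (fun x hx => ?_)
    he.exists_apply_eq σ hσ n
  · refine (hB.denseRange n).mono ?_
    rintro _ ⟨a, rfl⟩
    exact ⟨_, hprBτ n a⟩
  -- The compatibilities of the ladder are equalities of continuous maps into Hausdorff spaces, so
  -- they can be checked on the dense image of `A`.
  · refine congrFun ((hA.denseRange _).equalizer ((hi k).comp (hsc k)) (hTAc _) (funext fun a => ?_))
    simp [hspr, hprB, hTA]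
  · refine congrFun ((hA.denseRange _).equalizer ((hτB k).comp (hsc (k + 1)))
      ((hsc k).comp (hTAc _)) (funext fun a => ?_))
    simp [hspr, hprBτ, hTA]
  · refine congrFun ((hB.denseRange _).equalizer ((hsc k).comp (hi _)) (hTBc _)
      (funext fun a => ?_))
    simp [hspr, hprB, hTB]
  · refine he.1.injective (funext fun n => ?_)
    simp [hx]
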